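/- Throughout, $k$ is a positive integer, and for a matrix $\gamma=\begin{pmatrix}a&b\\c&d\end{pmatrix}$ with positive determinant $(f|\gamma)(\tau)=(\det\gamma)^{k/2}(c\tau+d)^{-k}f(\gamma\tau)$ is the weight $k$ slash operator. Put $V(d)=\begin{pmatrix}d&0\\0&1\end{pmatrix}$ and $W_N=\begin{pmatrix}0&-1\\N&0\end{pmatrix}$, so $(f|V(d))(\tau)=d^{k/2}f(d\tau)$. For cusp forms $f,g$ of weight $k$ on a finite index subgroup $\Gamma\subseteq\mathrm{SL}_2(\mathbb Z)$ let $$\langle f,g\rangle=\frac{1}{[\mathrm{SL}_2(\mathbb Z):\Gamma]}\iint_{\Gamma\backslash\mathbb H}f(x+iy)\overline{g(x+iy)}\,y^k\,\frac{dx\,dy}{y^2},$$ which does not change when $\Gamma=\Gamma_0(N)$ is replaced by a smaller $\Gamma_0(N')$; thus $\langle f,f|V(d)\rangle$ is taken on $\Gamma_0(dN)$ for $f$ of level $N$. Let $\mathcal S_k^{\mathrm{new}}(\Gamma_0(N))$ be the orthogonal complement in $\mathcal S_k(\Gamma_0(N))$ of the sum of the spaces $\mathcal S_k(\Gamma_0(M))|V(d)$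 over $M\mid N$, $M<N$, $d\mid N/M$. A normalized newform of level $N$ is an $f=\sum_{n\ge1}a_f(n)e^{2\pi i n\tau}\in\mathcal S_k^{\mathrm{new}}(\Gamma_0(N))$ that is an eigenform of all Hecke operators and satisfies $a_f(1)=1$. **Lemma.** (a) If $f$ is a normalized newform of weight $k$ and level $4$, then $\langle f,f|V(2^l)\rangle=0$ for all $l\ge1$. (b) If $f$ is a normalized newform of weight $k$ and level $2$, then $f|W_2=\lambda_2(f)f$ for some $\lambda_2(f)\in\{\pm1\}$, and for all $l\ge0$ $$\langle f,f|V(2^l)\rangle=\left(-\frac{\lambda_2(f)}{2}\right)^l\langle f,f\rangle.$$ (c) If $f$ is a normalized newform of weight $k$ and level $1$, then $$\langle f,f|V(2)\rangle=\frac13\cdot\frac{a_f(2)}{2^{k/2-1}}\langle f,f\rangle,$$ $$\langle f,f|V(4)\rangle=\left(\frac16\cdot\frac{a_f(2)^2}{4^{k/2-1}}-\frac12\right)\langle f,f\rangle,$$ $$\langle f,f|V(8)\rangle=\left(\frac1{12}\cdot\frac{a_f(2)^3}{8^{k/2-1}}-\frac5{12}\cdot\frac{a_f(2)}{2^{k/2-1}}\right)\langle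 f,f\rangle,$$ $$\langle f,f|V(16)\rangle=\left(\frac1{24}\cdot\frac{a_f(2)^4}{16^{k/2-1}}-\frac7{24}\cdot\frac{a_f(2)^2}{4^{k/2-1}}+\frac14\right)\langle f,f\rangle.$$ -/

import Mathlib

open UpperHalfPlane MeasureTheory CongruenceSubgroup
open scoped MatrixGroups Modular

noncomputable section

namespace VNewform

/-- The space `S_k(Γ₀(N))` of holomorphic cusp forms of weight `k` and level `N`. -/
abbrev CuspSpace (N : ℕ) (k : ℤ) : Type :=
  CuspForm ((Gamma0 N).map (Matrix.SpecialLinearGroup.mapGL ℝ)) k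

/-- The weight `k` slash operator for matrices `γ = (a b; c d)` of positive determinant, normalized
by `det ^ (k / 2)`: `(f |_k γ)(τ) = (det γ) ^ (k / 2) (c τ + d) ^ (-k) f (γ τ)`.
(Mathlib's slash operator has the factor `det ^ (k - 1)` instead.) -/
def slash (k : ℤ) (f : ℍ → ℂ) (γ : GL (Fin 2) ℝ) : ℍ → ℂ := fun τ ↦
  (((γ.det.val : ℝ) ^ ((k : ℝ) / 2) : ℝ) : ℂ) * denom γ τ ^ (-k) * f (γ • τ)

/-- The matrix `V(d) = (d 0; 0 1)`. -/
def matV (d : ℕ+) : GL (Fin 2) ℝ :=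
  Matrix.GeneralLinearGroup.mkOfDetNeZero !![(d : ℝ), 0; 0, 1] (by simp)

/-- The matrix `W_N = (0 -1; N 0)` of the Fricke involution. -/
def matW (N : ℕ+) : GL (Fin 2) ℝ :=
  Matrix.GeneralLinearGroup.mkOfDetNeZero !![0, -1; (N : ℝ), 0] (by simp)

/-- The matrix `(1 b; 0 d)`. -/
def matB (b : ℕ) (d : ℕ+) : GL (Fin 2) ℝ :=
  Matrix.GeneralLinearGroup.mkOfDetNeZero !![1, (b : ℝ); 0, (d : ℝ)] (by simp)

/-- The Petersson inner product of weight `k` for a subgroup `Γ` of `SL(2, ℤ)`,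
`[SL(2, ℤ) : Γ]⁻¹ ∫_{Γ \ ℍ} f(τ) conj(g(τ)) y ^ k dx dy / y ^ 2`.
The integral over `Γ \ ℍ` is the integral over the union of the translates `γ 𝒟` of the standard
fundamental domain `𝒟` of `SL(2, ℤ)`, for `γ = s⁻¹` with `s` running through representatives of the
cosets `s Γ` (so that `γ` represents the cosets `Γ γ`). `volume` on `ℍ` is `dx dy / y ^ 2`, and
`petersson k g f τ` is `conj (g τ) * f τ * y ^ k`. -/
def pet (Γ : Subgroup SL(2, ℤ)) (k : ℤ) (f g : ℍ → ℂ) : ℂ :=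
  (Γ.index : ℂ)⁻¹ *
    ∑ᶠ s : SL(2, ℤ) ⧸ Γ, ∫ τ in 𝒟, petersson k g f ((Quotient.out s)⁻¹ • τ)

/-- The `n`-th Fourier coefficient of `f(τ) = ∑ a(n) e^{2πinτ}`. -/
def coeff (f : ℍ → ℂ) (n : ℕ) : ℂ := (qExpansion 1 f).coeff n

/-- The space of oldforms of level `N`: the sum of the spaces `S_k(Γ₀(M)) | V(d)` over `M < N`
and `d` with `M ∣ N` and `d ∣ N / M`. -/
def oldSpace (N : ℕ) (k : ℤ) : Submodule ℂ (ℍ → ℂ) :=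
  Submodule.span ℂ {h | ∃ (M : ℕ) (d : ℕ+) (g : CuspSpace M k),
    M < N ∧ M * (d : ℕ) ∣ N ∧ h = slash k g (matV d)}

/-- The Hecke operator `T(p)` (`p` prime) of weight `k` and level `N` with trivial character:
`T(p) f = p ^ (k / 2 - 1) (∑_{0 ≤ b < p} f | (1 b; 0 p) + [p ∤ N] f | (p 0; 0 1))`, which
on Fourier coefficients is `a(n) ↦ a(p n) + [p ∤ N] p ^ (k - 1) a(n / p)`. -/
def heckeT (N : ℕ) (k : ℤ) (p : ℕ+) (f : ℍ → ℂ) : ℍ → ℂ :=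
  ((((p : ℕ) : ℝ) ^ ((k : ℝ) / 2 - 1) : ℝ) : ℂ) •
    ((∑ b ∈ Finset.range p, slash k f (matB b p)) +
      if (p : ℕ) ∣ N then 0 else slash k f (matV p))

/-- A normalized newform of weight `k` and level `N`: an element of `S_k(Γ₀(N))` that is orthogonal
to all oldforms, is an eigenform of all Hecke operators (equivalently, of `T(p)` for all primes `p`,
including those dividing `N`), and has `a(1) = 1`. -/
structure IsNormalizedNewform (N : ℕ) (k : ℤ) (f : CuspSpace N k) : Prop where
  new : ∀ h ∈ oldSpace N k, pet (Gamma0 N) k f h = 0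
  eigen : ∀ p : ℕ+, (p : ℕ).Prime → ∃ c : ℂ, heckeT N k p f = c • (f : ℍ → ℂ)
  normalized : coeff f 1 = 1

/-- The inner product `⟨f, f | V(d)⟩` of a form `f` of level `N` with `f | V(d)`, taken
on `Γ₀(d N)`, on which both are modular. -/
def petV (N : ℕ) (k : ℤ) (f : ℍ → ℂ) (d : ℕ+) : ℂ :=
  pet (Gamma0 (d * N)) k f (slash k f (matV d))

end VNewform

end

/-!
The Petersson product `⟨f, g⟩` is the mean of the integrals over the standard fundamental domain of
the finitely many `SL(2, ℤ)`-translates of the function `f(τ) conj(g(τ)) y ^ k`. So it depends on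
no level and is invariant under every rational matrix of positive determinant. Hence
`U(p) = ∑ (1 b; 0 p)` and `p V(p)` are adjoint on forms invariant under `T`, and an eigenvalue
equation for `f` at `p` turns into a recursion for `⟨f, f | V(p ^ l)⟩`: of first order if
`U(p) f = μ f`, of second order if `U(p) f + f | V(p) = μ f`.

It remains to find `μ`. In level `N` prime to `p` it is read off the Fourier coefficient `a(p)`.
If `p ^ 2 ∣ N`, then `U(p)` lowers the level, so `μ = 0`. In level `p`, the trace
`U(p) f + f | W_p` of `f | W_p` has level `1`, and its product with itself is a multiple of the
product of `f` with an oldform; hence it vanishes and `f | W_p = -μ f`.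
-/

noncomputable section

namespace VNewform

open scoped Pointwise ModularForm Manifold
open Matrix.SpecialLinearGroup (mapGL)

lemma volume_setOf_re_eq (c : ℝ) : volume {z : ℂ | z.re = c} = 0 := by
  have hset : {z : ℂ | z.re = c} = Complex.measurableEquivRealProd ⁻¹' ({c} ×ˢ Set.univ) := by
    ext z; simp
  rw [hset, Complex.volume_preserving_equiv_real_prod.measure_preimage_equiv,
    Measure.volume_eq_prod, Measure.prod_prod, Real.volume_singleton, zero_mul]

lemma volume_eq_zero_of_volume_coe_image_eq_zero {s : Set ℍ}
    (h : volume ((↑) '' s : Set ℂ) = 0) : volume s = 0 := by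
  rw [volume_eq_lintegral, Measure.restrict_eq_zero.mpr h, lintegral_zero_measure]

lemma coe_mem_of_mem_fd_diff_fdo {τ : ℍ} (hτ : τ ∈ 𝒟 \ 𝒟ᵒ) :
    (τ : ℂ) ∈ Metric.sphere (0 : ℂ) 1 ∪ ({z | z.re = 1 / 2} ∪ {z | z.re = -(1 / 2)}) := by
  obtain ⟨⟨h_norm, h_re⟩, h_boundary⟩ := hτ
  rcases h_norm.eq_or_lt with h_norm | h_norm
  · left
    rw [Complex.normSq_eq_norm_sq] at h_norm
    simpa using (pow_eq_one_iff_of_nonneg (norm_nonneg _) two_ne_zero).mp h_norm.symm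
  · exact .inr (eq_or_eq_neg_of_abs_eq
      (h_re.antisymm (not_lt.mp fun h_re' ↦ h_boundary ⟨h_norm, h_re'⟩)))

lemma volume_fd_diff_fdo : volume (𝒟 \ 𝒟ᵒ : Set ℍ) = 0 := by
  refine volume_eq_zero_of_volume_coe_image_eq_zero (measure_mono_null
    (Set.image_subset_iff.mpr fun _ ↦ coe_mem_of_mem_fd_diff_fdo) ?_)
  exact measure_union_null (Measure.addHaar_sphere _ _ _)
    (measure_union_null (volume_setOf_re_eq _) (volume_setOf_re_eq _))

lemma coe_image_fd_subset_strip : ((↑) '' (𝒟 : Set ℍ) : Set ℂ) ⊆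
    Complex.measurableEquivRealProd ⁻¹' (Set.Icc (-(1 / 2)) (1 / 2) ×ˢ Set.Ioi (1 / 2)) := by
  rintro _ ⟨τ, hτ, rfl⟩
  have h_im := ModularGroup.three_le_four_mul_im_sq_of_mem_fd hτ
  have h_pos := τ.im_pos
  exact ⟨abs_le.mp hτ.2, show 1 / 2 < τ.im by nlinarith⟩

lemma setLIntegral_Ioi_inv_sq_lt_top {c : ℝ} (hc : 0 < c) :
    ∫⁻ y in Set.Ioi c, ((1 / ‖y‖₊) ^ 2 : NNReal) < ⊤ := by
  have h_int : IntegrableOn (fun y : ℝ ↦ y ^ (-2 : ℝ)) (Set.Ioi c) :=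
    integrableOn_Ioi_rpow_of_lt (by norm_num) hc
  refine lt_of_le_of_lt (setLIntegral_mono' measurableSet_Ioi fun y hy ↦ ?_) h_int.2
  have hy_pos : 0 < y := hc.trans hy
  rw [enorm_eq_nnnorm, ENNReal.coe_le_coe, ← NNReal.coe_le_coe]
  simp [Real.rpow_neg hy_pos.le, abs_of_pos hy_pos]

lemma volume_fd_lt_top : volume (𝒟 : Set ℍ) < ⊤ := by
  rw [volume_eq_lintegral]
  refine (lintegral_mono_set coe_image_fd_subset_strip).trans_lt ?_
  have h_prod := Complex.volume_preserving_equiv_real_prod.setLIntegral_comp_preimage_emb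
    Complex.measurableEquivRealProd.measurableEmbedding
    (fun p : ℝ × ℝ ↦ (↑((1 / ‖p.2‖₊) ^ 2 : NNReal) : ENNReal))
    (Set.Icc (-(1 / 2)) (1 / 2) ×ˢ Set.Ioi (1 / 2))
  simp only [Complex.measurableEquivRealProd_apply] at h_prod
  rw [h_prod, Measure.volume_eq_prod, ← Measure.prod_restrict, lintegral_prod _ (by fun_prop)]
  simp only [lintegral_const]
  exact ENNReal.mul_lt_top (setLIntegral_Ioi_inv_sq_lt_top (by norm_num)) (by simp)

instance isOpenPosMeasure_volume : (volume : Measure ℍ).IsOpenPosMeasure := by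
  have := Measure.IsOpenPosMeasure.comap (volume : Measure ℂ) isOpenEmbedding_coe
  have im_ne_zero (τ : ℍ) : NNReal.mk τ.im τ.im_pos.le ≠ 0 := NNReal.ne_iff.mp τ.im_ne_zero
  refine Measure.AbsolutelyContinuous.isOpenPosMeasure (μ := volume.comap UpperHalfPlane.coe) ?_
  rw [volume_def]
  refine withDensity_absolutelyContinuous' ?_ (.of_forall fun τ ↦
    ENNReal.coe_ne_zero.mpr (pow_ne_zero 2 (one_div_ne_zero (im_ne_zero τ))))
  have h_im : Continuous fun τ : ℍ ↦ NNReal.mk τ.im τ.im_pos.le := continuous_im.subtype_mk _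
  have h_density : Continuous fun τ : ℍ ↦ (1 / NNReal.mk τ.im τ.im_pos.le) ^ 2 :=
    (continuous_const.div₀ h_im im_ne_zero).pow 2
  exact h_density.measurable.coe_nnreal_ennreal.aemeasurable

lemma two_I_mem_fdo : (⟨2 * Complex.I, by simp⟩ : ℍ) ∈ 𝒟ᵒ := by
  constructor
  · norm_num [Complex.normSq_apply]
  · simp [UpperHalfPlane.re]

lemma volume_fd_ne_zero : volume (𝒟 : Set ℍ) ≠ 0 := fun h ↦
  ModularGroup.isOpen_fdo.measure_ne_zero volume ⟨_, two_I_mem_fdo⟩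
    (measure_mono_null (ModularGroup.fdo_eq_interior_fd ▸ interior_subset) h)

lemma measureReal_fd_ne_zero : volume.real (𝒟 : Set ℍ) ≠ 0 :=
  (measureReal_ne_zero_iff volume_fd_lt_top.ne).mpr volume_fd_ne_zero

/-- The action of `SL(2, ℤ)` on `ℍ` as a homomorphism to the permutations of `ℍ`. As `-1` acts
trivially, it is the image of a subgroup `Γ` under `modPerm`, not `Γ` itself, that has fundamental
domains. -/
def modPerm : SL(2, ℤ) →* Equiv.Perm ℍ := MulAction.toPermHom SL(2, ℤ) ℍ

lemma modPerm_apply (γ : SL(2, ℤ)) (τ : ℍ) : modPerm γ τ = γ • τ := rfl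

lemma modPerm_smul_set (γ : SL(2, ℤ)) (s : Set ℍ) : modPerm γ • s = γ • s := rfl

lemma mem_ker_modPerm_iff {γ : SL(2, ℤ)} : γ ∈ modPerm.ker ↔ γ = 1 ∨ γ = -1 := by
  constructor
  · intro hγ
    refine ModularGroup.eq_one_or_neg_one_of_mem_fdo_mem_fd two_I_mem_fdo ?_
    rw [← modPerm_apply, MonoidHom.mem_ker.mp hγ]
    exact (ModularGroup.fdo_eq_interior_fd ▸ interior_subset) two_I_mem_fdo
  · rintro (rfl | rfl)
    · exact modPerm.ker.one_mem
    · ext τ : 1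
      simp [modPerm_apply]

lemma mem_of_modPerm_mem_map {Γ : Subgroup SL(2, ℤ)} (hΓ : -1 ∈ Γ) {γ : SL(2, ℤ)}
    (hγ : modPerm γ ∈ Γ.map modPerm) : γ ∈ Γ := by
  have ker_le : modPerm.ker ≤ Γ := fun δ hδ ↦
    (mem_ker_modPerm_iff.mp hδ).elim (· ▸ Γ.one_mem) (· ▸ hΓ)
  rwa [← Subgroup.mem_comap, Subgroup.comap_map_eq_self ker_le] at hγ

lemma measurePreserving_smul_SL (γ : SL(2, ℤ)) :
    MeasurePreserving (fun τ : ℍ ↦ γ • τ) volume volume :=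
  measurePreserving_smul (mapGL ℝ γ) volume

lemma preimage_inv_smul_fd (γ : SL(2, ℤ)) : (γ⁻¹ • ·) ⁻¹' 𝒟 = (γ • 𝒟 : Set ℍ) :=
  Set.ext fun _ ↦ (Set.mem_smul_set_iff_inv_smul_mem).symm

lemma measurableSet_smul_fd (γ : SL(2, ℤ)) : MeasurableSet (γ • 𝒟 : Set ℍ) := by
  rw [← preimage_inv_smul_fd]
  exact (measurePreserving_smul_SL γ⁻¹).measurable ModularGroup.isClosed_fd.measurableSet

lemma measure_smul_fd (γ : SL(2, ℤ)) : volume (γ • 𝒟 : Set ℍ) = volume (𝒟 : Set ℍ) := by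
  rw [← preimage_inv_smul_fd, (measurePreserving_smul_SL γ⁻¹).measure_preimage
    ModularGroup.isClosed_fd.measurableSet.nullMeasurableSet]

lemma setIntegral_smul_fd (γ : SL(2, ℤ)) (φ : ℍ → ℂ) :
    ∫ τ in γ • 𝒟, φ τ = ∫ τ in 𝒟, φ (γ • τ) := by
  rw [← (measurePreserving_smul_SL γ).setIntegral_preimage_emb
    (measurableEmbedding_const_smul (mapGL ℝ γ)) φ (γ • 𝒟 : Set ℍ)]
  congr 2
  ext τ
  exact Set.smul_mem_smul_set_iff

lemma aedisjoint_smul_fd_fd {γ : SL(2, ℤ)} (hγ : modPerm γ ≠ 1) :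
    AEDisjoint volume (γ • 𝒟 : Set ℍ) 𝒟 := by
  refine measure_mono_null ?_ volume_fd_diff_fdo
  rintro τ ⟨hτγ, hτ⟩
  refine ⟨hτ, fun hτo ↦ hγ ?_⟩
  rw [Set.mem_smul_set_iff_inv_smul_mem] at hτγ
  exact modPerm.ker.inv_mem_iff.mp (mem_ker_modPerm_iff.mpr
    (ModularGroup.eq_one_or_neg_one_of_mem_fdo_mem_fd hτo hτγ))

lemma aedisjoint_smul_fd {γ δ : SL(2, ℤ)} (hγδ : modPerm γ ≠ modPerm δ) :
    AEDisjoint volume (γ • 𝒟 : Set ℍ) (δ • 𝒟) := by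
  have h_ne : modPerm (δ⁻¹ * γ) ≠ 1 := by
    rwa [map_mul, map_inv, ne_eq, inv_mul_eq_one, eq_comm]
  have h_disj := (aedisjoint_smul_fd_fd h_ne).preimage
    (measurePreserving_smul_SL δ⁻¹).quasiMeasurePreserving
  convert h_disj using 1
  · ext τ
    simp [Set.mem_smul_set_iff_inv_smul_mem, smul_smul]
  · exact (preimage_inv_smul_fd δ).symm

/-- The union of the translates of `𝒟` by the inverses of the representatives of the cosets
`s Γ`: the set over which `pet Γ` integrates, a fundamental domain of `Γ`. -/
def fundSet (Γ : Subgroup SL(2, ℤ)) : Set ℍ :=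
  ⋃ s : SL(2, ℤ) ⧸ Γ, (Quotient.out s)⁻¹ • (𝒟 : Set ℍ)

section FundamentalDomain

variable {Γ : Subgroup SL(2, ℤ)}

lemma eq_and_eq_one_of_mul_modPerm_out_inv_eq (hΓ : -1 ∈ Γ) {p : Equiv.Perm ℍ}
    (hp : p ∈ Γ.map modPerm) {s t : SL(2, ℤ) ⧸ Γ}
    (h : p * modPerm (Quotient.out s)⁻¹ = modPerm (Quotient.out t)⁻¹) : s = t ∧ p = 1 := by
  have hst : s = t := by
    rw [← QuotientGroup.out_eq' s, ← QuotientGroup.out_eq' t]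
    refine QuotientGroup.eq.mpr (mem_of_modPerm_mem_map hΓ ?_)
    have hp_inv : modPerm ((Quotient.out s)⁻¹ * Quotient.out t) = p⁻¹ := by
      rw [← inv_inj, map_mul, mul_inv_rev, ← map_inv, ← h, map_inv]
      group
    exact hp_inv ▸ inv_mem hp
  subst hst
  exact ⟨rfl, mul_eq_right.mp h⟩

lemma aedisjoint_smul_out_inv_smul_fd (hΓ : -1 ∈ Γ) {p : Equiv.Perm ℍ}
    (hp : p ∈ Γ.map modPerm) {s t : SL(2, ℤ) ⧸ Γ} (h : ¬(s = t ∧ p = 1)) :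
    AEDisjoint volume (p • (Quotient.out s)⁻¹ • 𝒟 : Set ℍ) ((Quotient.out t)⁻¹ • 𝒟) := by
  obtain ⟨γ, hγ, rfl⟩ := hp
  rw [modPerm_smul_set, smul_smul]
  refine aedisjoint_smul_fd fun h_eq ↦
    h (eq_and_eq_one_of_mul_modPerm_out_inv_eq hΓ ⟨γ, hγ, rfl⟩ ?_)
  rw [← h_eq, map_mul]

lemma pairwise_aedisjoint_out_inv_smul_fd (hΓ : -1 ∈ Γ) :
    Pairwise (Function.onFun (AEDisjoint volume)
      fun s : SL(2, ℤ) ⧸ Γ ↦ ((Quotient.out s)⁻¹ • 𝒟 : Set ℍ)) := fun s t hst ↦ by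
  simpa using aedisjoint_smul_out_inv_smul_fd hΓ (one_mem _) (s := s) (t := t) (hst ·.1)

instance countable_SL : Countable SL(2, ℤ) :=
  have : Countable (Matrix (Fin 2) (Fin 2) ℤ) := inferInstanceAs (Countable (Fin 2 → Fin 2 → ℤ))
  Subtype.countable

instance countable_map_modPerm : Countable (Γ.map modPerm) :=
  ((Set.to_countable (Γ : Set SL(2, ℤ))).image modPerm).to_subtype

lemma measurePreserving_smul_of_mem_map_modPerm {p : Equiv.Perm ℍ} (hp : p ∈ Γ.map modPerm) :
    MeasurePreserving (fun τ : ℍ ↦ p • τ) volume volume := by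
  obtain ⟨γ, -, rfl⟩ := hp
  exact measurePreserving_smul_SL γ

instance measurableConstSMul_map_modPerm : MeasurableConstSMul (Γ.map modPerm) ℍ where
  measurable_const_smul p := (measurePreserving_smul_of_mem_map_modPerm p.2).measurable

instance smulInvariantMeasure_map_modPerm : SMulInvariantMeasure (Γ.map modPerm) ℍ volume where
  measure_preimage_smul p _ hs :=
    (measurePreserving_smul_of_mem_map_modPerm p.2).measure_preimage hs.nullMeasurableSet

lemma exists_smul_mem_fundSet (τ : ℍ) : ∃ p : Γ.map modPerm, p • τ ∈ fundSet Γ := by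
  obtain ⟨g, hg⟩ := ModularGroup.exists_smul_mem_fd τ
  obtain ⟨γ, hγ⟩ := QuotientGroup.mk_out_eq_mul Γ g
  refine ⟨⟨modPerm (γ : SL(2, ℤ))⁻¹, _, Γ.inv_mem γ.2, rfl⟩,
    Set.mem_iUnion.mpr ⟨(g : SL(2, ℤ) ⧸ Γ), ?_⟩⟩
  rw [Set.mem_smul_set_iff_inv_smul_mem, inv_inv]
  change Quotient.out (QuotientGroup.mk g : SL(2, ℤ) ⧸ Γ) • ((γ : SL(2, ℤ))⁻¹ • τ) ∈ _
  rwa [hγ, smul_smul, mul_inv_cancel_right]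

lemma isFundamentalDomain_fundSet (hΓ : -1 ∈ Γ) :
    IsFundamentalDomain (Γ.map modPerm) (fundSet Γ) := by
  have : Countable (SL(2, ℤ) ⧸ Γ) := QuotientGroup.mk_surjective.countable
  refine .mk'' (MeasurableSet.iUnion fun s ↦ measurableSet_smul_fd _).nullMeasurableSet
    (.of_forall exists_smul_mem_fundSet) ?_
    fun p ↦ (measurePreserving_smul p volume).quasiMeasurePreserving
  intro p hp
  have h_smul : p • fundSet Γ =
      ⋃ s : SL(2, ℤ) ⧸ Γ, (p : Equiv.Perm ℍ) • (Quotient.out s)⁻¹ • (𝒟 : Set ℍ) :=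
    Set.smul_set_iUnion _ _
  rw [h_smul, fundSet, AEDisjoint.iUnion_left_iff]
  exact fun s ↦ AEDisjoint.iUnion_right_iff.mpr fun t ↦
    aedisjoint_smul_out_inv_smul_fd hΓ p.2 fun h ↦ hp (Subtype.ext h.2)

lemma volume_fundSet [Γ.FiniteIndex] (hΓ : -1 ∈ Γ) :
    volume (fundSet Γ) = Γ.index * volume (𝒟 : Set ℍ) := by
  have := Fintype.ofFinite (SL(2, ℤ) ⧸ Γ)
  rw [fundSet, measure_iUnion₀ (pairwise_aedisjoint_out_inv_smul_fd hΓ)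
    (fun s ↦ (measurableSet_smul_fd _).nullMeasurableSet)]
  simp [measure_smul_fd, tsum_fintype, Subgroup.index, Nat.card_eq_fintype_card]

lemma setIntegral_fundSet [Γ.FiniteIndex] (hΓ : -1 ∈ Γ) {φ : ℍ → ℂ} (hφ : Continuous φ)
    {C : ℝ} (hC : ∀ τ, ‖φ τ‖ ≤ C) :
    ∫ τ in fundSet Γ, φ τ = ∑ᶠ s : SL(2, ℤ) ⧸ Γ, ∫ τ in 𝒟, φ ((Quotient.out s)⁻¹ • τ) := by
  have := Fintype.ofFinite (SL(2, ℤ) ⧸ Γ)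
  have h_int (γ : SL(2, ℤ)) : IntegrableOn φ (γ • 𝒟 : Set ℍ) :=
    Measure.integrableOn_of_bounded (by rw [measure_smul_fd]; exact volume_fd_lt_top.ne)
      hφ.aestronglyMeasurable (.of_forall hC)
  rw [finsum_eq_sum_of_fintype, fundSet,
    integral_iUnion_ae (fun s ↦ (measurableSet_smul_fd _).nullMeasurableSet)
      (pairwise_aedisjoint_out_inv_smul_fd hΓ)
      (integrableOn_finite_iUnion.mpr fun s ↦ h_int _), tsum_fintype]
  exact Finset.sum_congr rfl fun s _ ↦ setIntegral_smul_fd _ φ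

end FundamentalDomain

/-- The mean value over `Γ \ ℍ` of a `Γ`-invariant function, scaled by the volume of `𝒟`. -/
def mean (Γ : Subgroup SL(2, ℤ)) (φ : ℍ → ℂ) : ℂ :=
  (Γ.index : ℂ)⁻¹ * ∑ᶠ s : SL(2, ℤ) ⧸ Γ, ∫ τ in 𝒟, φ ((Quotient.out s)⁻¹ • τ)

/-- The subgroup of the modular group that leaves `φ` invariant. -/
def modStab (φ : ℍ → ℂ) : Subgroup SL(2, ℤ) where
  carrier := {γ | ∀ τ, φ (γ • τ) = φ τ}
  mul_mem' hγ hδ τ := by rw [mul_smul, hγ, hδ]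
  one_mem' τ := by rw [one_smul]
  inv_mem' {γ} hγ τ := by rw [← hγ, smul_inv_smul]

lemma neg_one_mem_modStab (φ : ℍ → ℂ) : -1 ∈ modStab φ := fun τ ↦ by simp

/-- A continuous bounded function on `ℍ` that is invariant under some finite index subgroup of the
modular group. -/
structure IsModularFunction (φ : ℍ → ℂ) : Prop where
  continuous : Continuous φ
  bounded : ∃ C, ∀ τ, ‖φ τ‖ ≤ C
  finiteIndex : (modStab φ).FiniteIndex

/-- The mean value of `φ` over `Γ \ ℍ`, for the largest `Γ` under which `φ` is invariant. -/
def stabMean (φ : ℍ → ℂ) : ℂ := mean (modStab φ) φ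

lemma finsum_quotientMapOfLE {G : Type*} [Group G] {H K : Subgroup G} [H.FiniteIndex] (h : H ≤ K)
    (F : G ⧸ K → ℂ) :
    ∑ᶠ s : G ⧸ H, F (Subgroup.quotientMapOfLE h s) = H.relIndex K * ∑ᶠ t : G ⧸ K, F t := by
  have : K.FiniteIndex := Subgroup.finiteIndex_of_le h
  have := Fintype.ofFinite (G ⧸ H)
  have := Fintype.ofFinite (G ⧸ K)
  have := Fintype.ofFinite (K ⧸ H.subgroupOf K)
  have h_fst (s : G ⧸ H) :
      Subgroup.quotientMapOfLE h s = (Subgroup.quotientEquivProdOfLE h s).1 := by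
    induction s using QuotientGroup.induction_on with | H g => rfl
  simp only [finsum_eq_sum_of_fintype, h_fst]
  rw [Equiv.sum_comp (Subgroup.quotientEquivProdOfLE h) fun p ↦ F p.1, Fintype.sum_prod_type]
  simp [Finset.mul_sum, Subgroup.relIndex, Subgroup.index, Nat.card_eq_fintype_card]

lemma apply_out_inv_smul {Γ : Subgroup SL(2, ℤ)} {φ : ℍ → ℂ} (hφ : Γ ≤ modStab φ)
    (g : SL(2, ℤ)) (τ : ℍ) :
    φ ((Quotient.out (QuotientGroup.mk g : SL(2, ℤ) ⧸ Γ))⁻¹ • τ) = φ (g⁻¹ • τ) := by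
  obtain ⟨γ, hγ⟩ := QuotientGroup.mk_out_eq_mul Γ g
  rw [hγ, mul_inv_rev, mul_smul, hφ (Γ.inv_mem γ.2)]

lemma mean_eq_mean_of_le {Γ' Γ : Subgroup SL(2, ℤ)} [Γ'.FiniteIndex] (h : Γ' ≤ Γ) {φ : ℍ → ℂ}
    (hφ : Γ ≤ modStab φ) : mean Γ' φ = mean Γ φ := by
  have h_factor (s : SL(2, ℤ) ⧸ Γ') : ∫ τ in 𝒟, φ ((Quotient.out s)⁻¹ • τ) =
      ∫ τ in 𝒟, φ ((Quotient.out (Subgroup.quotientMapOfLE h s))⁻¹ • τ) := by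
    induction s using QuotientGroup.induction_on with
    | H g => simp only [Subgroup.quotientMapOfLE_apply_mk, apply_out_inv_smul hφ,
        apply_out_inv_smul (h.trans hφ)]
  have h_rel : (Γ'.relIndex Γ : ℂ) ≠ 0 := Nat.cast_ne_zero.mpr
    (left_ne_zero_of_mul (Subgroup.relIndex_mul_index h ▸ Subgroup.FiniteIndex.index_ne_zero))
  simp only [mean, h_factor]
  rw [finsum_quotientMapOfLE h fun t ↦ ∫ τ in 𝒟, φ ((Quotient.out t)⁻¹ • τ),
    ← Subgroup.relIndex_mul_index h]
  push_cast
  field_simp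

lemma mean_eq_stabMean {Γ : Subgroup SL(2, ℤ)} [Γ.FiniteIndex] {φ : ℍ → ℂ} (h : Γ ≤ modStab φ) :
    mean Γ φ = stabMean φ :=
  mean_eq_mean_of_le h le_rfl

lemma mean_eq_setAverage_fundSet {Γ : Subgroup SL(2, ℤ)} [Γ.FiniteIndex] (hΓ : -1 ∈ Γ)
    {φ : ℍ → ℂ} (hφ : Continuous φ) {C : ℝ} (hC : ∀ τ, ‖φ τ‖ ≤ C) :
    mean Γ φ = volume.real (𝒟 : Set ℍ) * ⨍ τ in fundSet Γ, φ τ := by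
  have h_vol : volume.real (fundSet Γ) = Γ.index * volume.real (𝒟 : Set ℍ) := by
    simp [Measure.real, volume_fundSet hΓ]
  have h_fd : (volume.real (𝒟 : Set ℍ) : ℂ) ≠ 0 := Complex.ofReal_ne_zero.mpr measureReal_fd_ne_zero
  rw [setAverage_eq, setIntegral_fundSet hΓ hφ hC, h_vol, mean, Complex.real_smul]
  push_cast
  field_simp

lemma setAverage_eq_of_isFundamentalDomain {Γ : Subgroup SL(2, ℤ)} {s t : Set ℍ}
    (hs : IsFundamentalDomain (Γ.map modPerm) s) (ht : IsFundamentalDomain (Γ.map modPerm) t)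
    {φ : ℍ → ℂ} (hφ : Γ ≤ modStab φ) : ⨍ τ in s, φ τ = ⨍ τ in t, φ τ := by
  have h_inv (p : Γ.map modPerm) (τ : ℍ) : φ (p • τ) = φ τ := by
    obtain ⟨_, γ, hγ, rfl⟩ := p
    exact hφ hγ τ
  rw [setAverage_eq, setAverage_eq, Measure.real, hs.measure_eq ht, hs.setIntegral_eq ht h_inv]
  rfl

lemma setAverage_comp_smul (α : GL (Fin 2) ℝ) (s : Set ℍ) (φ : ℍ → ℂ) :
    ⨍ τ in s, φ (α • τ) = ⨍ τ in MulAction.toPerm α '' s, φ τ := by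
  have h_mp : MeasurePreserving (fun τ : ℍ ↦ α • τ) volume volume := measurePreserving_smul α _
  have h_emb := measurableEmbedding_const_smul (α := ℍ) α
  have h_pre : (fun τ : ℍ ↦ α • τ) ⁻¹' (MulAction.toPerm α '' s) = s :=
    Set.preimage_image_eq _ (MulAction.injective α)
  have h_vol : volume.real s = volume.real (MulAction.toPerm α '' s) := by
    rw [Measure.real, Measure.real, ← h_mp.measure_preimage_emb h_emb (_ '' s), h_pre]
  have h_int := h_mp.setIntegral_preimage_emb h_emb φ (MulAction.toPerm α '' s)
  rw [setAverage_eq, setAverage_eq, ← h_int, h_pre, h_vol]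

lemma isFundamentalDomain_toPerm_image {Γ Γ' : Subgroup SL(2, ℤ)} {α : GL (Fin 2) ℝ}
    (hα : Γ'.map modPerm = (Γ.map modPerm).map (MulAut.conj (MulAction.toPerm α)).toMonoidHom)
    {s : Set ℍ} (hs : IsFundamentalDomain (Γ.map modPerm) s) :
    IsFundamentalDomain (Γ'.map modPerm) (MulAction.toPerm α '' s) := by
  let e : Γ.map modPerm ≃* Γ'.map modPerm :=
    ((MulAut.conj (MulAction.toPerm α)).subgroupMap _).trans (MulEquiv.subgroupCongr hα.symm)
  have he (q : Γ.map modPerm) (τ : ℍ) : e q • α • τ = α • q • τ :=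
    congrArg (fun σ : ℍ ↦ α • q • σ) (inv_smul_smul α τ)
  refine hs.image_of_equiv (MulAction.toPerm α)
    (measurePreserving_smul α⁻¹ (volume : Measure ℍ)).quasiMeasurePreserving e.symm.toEquiv
    fun p τ ↦ ?_
  obtain ⟨q, rfl⟩ := e.surjective p
  simpa using (he q τ).symm

lemma mean_comp_smul {Γ Γ' : Subgroup SL(2, ℤ)} [Γ.FiniteIndex] [Γ'.FiniteIndex] (hΓ : -1 ∈ Γ)
    (hΓ' : -1 ∈ Γ') {α : GL (Fin 2) ℝ}
    (hα : Γ'.map modPerm = (Γ.map modPerm).map (MulAut.conj (MulAction.toPerm α)).toMonoidHom)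
    {φ : ℍ → ℂ} (hφ : Γ' ≤ modStab φ) (h_cont : Continuous φ) {C : ℝ} (hC : ∀ τ, ‖φ τ‖ ≤ C) :
    mean Γ (fun τ ↦ φ (α • τ)) = mean Γ' φ := by
  have h_cont_comp : Continuous fun τ ↦ φ (α • τ) := h_cont.comp (continuous_const_smul α)
  rw [mean_eq_setAverage_fundSet hΓ h_cont_comp fun τ ↦ hC _,
    mean_eq_setAverage_fundSet hΓ' h_cont hC, setAverage_comp_smul,
    setAverage_eq_of_isFundamentalDomain
      (isFundamentalDomain_toPerm_image hα (isFundamentalDomain_fundSet hΓ))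
      (isFundamentalDomain_fundSet hΓ') hφ]

/-- The rational matrices in `GL(2, ℝ)`. -/
def ratGL : Subgroup (GL (Fin 2) ℝ) :=
  (Matrix.GeneralLinearGroup.map (n := Fin 2) (Rat.castHom ℝ)).range

lemma finiteIndex_conjGL_of_mem_ratGL (Γ : Subgroup SL(2, ℤ)) [Γ.FiniteIndex]
    {α : GL (Fin 2) ℝ} (hα : α ∈ ratGL) : (conjGL Γ α).FiniteIndex := by
  obtain ⟨β, hβ⟩ := ratGL.inv_mem hα
  have : (ConjAct.toConjAct α⁻¹ • Γ.map (mapGL ℝ)).IsArithmetic :=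
    hβ ▸ Subgroup.IsArithmetic.conj _ β
  exact Subgroup.IsArithmetic.finiteIndex_comap _

lemma mem_conjGL_iff {Γ : Subgroup SL(2, ℤ)} {α : GL (Fin 2) ℝ} {γ : SL(2, ℤ)} :
    γ ∈ conjGL Γ α ↔ ∃ δ ∈ Γ, mapGL ℝ δ = α * mapGL ℝ γ * α⁻¹ :=
  mem_conjGL

lemma conjGL_modStab_le (φ : ℍ → ℂ) (α : GL (Fin 2) ℝ) :
    conjGL (modStab φ) α ≤ modStab fun τ ↦ φ (α • τ) := by
  intro γ hγ τ
  obtain ⟨δ, hδ, h⟩ := mem_conjGL_iff.mp hγ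
  have h_smul : δ • α • τ = α • γ • τ := by
    change mapGL ℝ δ • α • τ = α • mapGL ℝ γ • τ
    rw [h, mul_smul, mul_smul, inv_smul_smul]
  change φ (α • γ • τ) = φ (α • τ)
  rw [← h_smul, hδ]

lemma map_modPerm_inf_conjGL_inv (Γ : Subgroup SL(2, ℤ)) (α : GL (Fin 2) ℝ) :
    (Γ ⊓ conjGL ⊤ α⁻¹).map modPerm =
      ((conjGL Γ α).map modPerm).map (MulAut.conj (MulAction.toPerm α)).toMonoidHom := by
  have conj_of_mapGL_eq {γ δ : SL(2, ℤ)} (h : mapGL ℝ δ = α * mapGL ℝ γ * α⁻¹) :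
      modPerm δ = MulAut.conj (MulAction.toPerm α) (modPerm γ) := by
    ext τ : 1
    change mapGL ℝ δ • τ = α • mapGL ℝ γ • α⁻¹ • τ
    rw [h, mul_smul, mul_smul]
  ext p
  constructor
  · rintro ⟨δ, ⟨hδ, hδ'⟩, rfl⟩
    obtain ⟨γ, -, hγ⟩ := mem_conjGL_iff.mp hδ'
    have h : mapGL ℝ δ = α * mapGL ℝ γ * α⁻¹ := by rw [hγ]; group
    exact ⟨_, ⟨γ, mem_conjGL_iff.mpr ⟨δ, hδ, h⟩, rfl⟩, (conj_of_mapGL_eq h).symm⟩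
  · rintro ⟨_, ⟨γ, hγ, rfl⟩, rfl⟩
    obtain ⟨δ, hδ, h⟩ := mem_conjGL_iff.mp hγ
    have h' : mapGL ℝ γ = α⁻¹ * mapGL ℝ δ * α⁻¹⁻¹ := by rw [h]; group
    exact ⟨δ, ⟨hδ, mem_conjGL_iff.mpr ⟨γ, trivial, h'⟩⟩, conj_of_mapGL_eq h⟩

lemma neg_one_mem_conjGL {Γ : Subgroup SL(2, ℤ)} (hΓ : -1 ∈ Γ) (α : GL (Fin 2) ℝ) :
    -1 ∈ conjGL Γ α :=
  mem_conjGL_iff.mpr ⟨-1, hΓ, by ext1; simp⟩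

namespace IsModularFunction

variable {φ ψ : ℍ → ℂ}

lemma stabMean_comp_smul (hφ : IsModularFunction φ) {α : GL (Fin 2) ℝ} (hα : α ∈ ratGL) :
    stabMean (fun τ ↦ φ (α • τ)) = stabMean φ := by
  have := hφ.finiteIndex
  have := finiteIndex_conjGL_of_mem_ratGL (modStab φ) hα
  have := finiteIndex_conjGL_of_mem_ratGL ⊤ (ratGL.inv_mem hα)
  obtain ⟨C, hC⟩ := hφ.bounded
  rw [← mean_eq_stabMean (conjGL_modStab_le φ α),
    ← mean_eq_stabMean (Γ := modStab φ ⊓ conjGL ⊤ α⁻¹) inf_le_left]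
  exact mean_comp_smul (Γ' := modStab φ ⊓ conjGL ⊤ α⁻¹)
    (neg_one_mem_conjGL (neg_one_mem_modStab φ) α)
    ⟨neg_one_mem_modStab φ, neg_one_mem_conjGL (Subgroup.mem_top _) _⟩
    (map_modPerm_inf_conjGL_inv _ α) inf_le_left hφ.continuous hC

lemma integrableOn_comp_smul_fd (hφ : IsModularFunction φ) (γ : SL(2, ℤ)) :
    IntegrableOn (fun τ ↦ φ (γ • τ)) (𝒟 : Set ℍ) := by
  obtain ⟨C, hC⟩ := hφ.bounded
  exact Measure.integrableOn_of_bounded volume_fd_lt_top.ne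
    (hφ.continuous.comp (continuous_const_smul (mapGL ℝ γ))).aestronglyMeasurable
    (.of_forall fun _ ↦ hC _)

lemma stabMean_add (hφ : IsModularFunction φ) (hψ : IsModularFunction ψ) :
    stabMean (φ + ψ) = stabMean φ + stabMean ψ := by
  have := hφ.finiteIndex
  have := hψ.finiteIndex
  have := Fintype.ofFinite (SL(2, ℤ) ⧸ (modStab φ ⊓ modStab ψ))
  have h_add : modStab φ ⊓ modStab ψ ≤ modStab (φ + ψ) :=
    fun γ hγ τ ↦ congrArg₂ (· + ·) (hγ.1 τ) (hγ.2 τ)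
  rw [← mean_eq_stabMean (Γ := modStab φ ⊓ modStab ψ) inf_le_left,
    ← mean_eq_stabMean (Γ := modStab φ ⊓ modStab ψ) inf_le_right, ← mean_eq_stabMean h_add]
  simp only [mean, finsum_eq_sum_of_fintype, ← mul_add, ← Finset.sum_add_distrib]
  exact congrArg _ (Finset.sum_congr rfl fun s _ ↦
    integral_add (hφ.integrableOn_comp_smul_fd _) (hψ.integrableOn_comp_smul_fd _))

lemma stabMean_smul (hφ : IsModularFunction φ) (c : ℂ) :
    stabMean (c • φ) = c * stabMean φ := by
  have := hφ.finiteIndex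
  have := Fintype.ofFinite (SL(2, ℤ) ⧸ modStab φ)
  have h_smul : modStab φ ≤ modStab (c • φ) := fun γ hγ τ ↦ congrArg (c • ·) (hγ τ)
  rw [← mean_eq_stabMean h_smul]
  simp only [stabMean, mean, finsum_eq_sum_of_fintype, mul_left_comm c, Finset.mul_sum,
    Pi.smul_apply, integral_const_mul, smul_eq_mul]

end IsModularFunction

lemma eq_zero_of_ae_eq_zero_on_fd {φ : ℍ → ℂ} (hφ : Continuous φ)
    (h : ∀ γ : SL(2, ℤ), ∀ᵐ τ ∂volume.restrict 𝒟, φ (γ • τ) = 0) : φ = 0 := by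
  have h_ae (γ : SL(2, ℤ)) : ∀ᵐ τ ∂volume, γ⁻¹ • τ ∈ 𝒟 → φ τ = 0 := by
    have h_fd := (ae_restrict_iff' ModularGroup.isClosed_fd.measurableSet).mp (h γ)
    filter_upwards [(measurePreserving_smul_SL γ⁻¹).quasiMeasurePreserving.ae h_fd] with τ hτ hmem
    simpa using hτ hmem
  refine (Continuous.ae_eq_iff_eq volume hφ continuous_const).mp ?_
  filter_upwards [ae_all_iff.mpr h_ae] with τ hτ
  obtain ⟨γ, hγ⟩ := ModularGroup.exists_smul_mem_fd τ
  exact hτ γ⁻¹ (by rwa [inv_inv])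

lemma eq_zero_of_stabMean_eq_zero {u : ℍ → ℝ} (hu : IsModularFunction fun τ ↦ (u τ : ℂ))
    (hu_nonneg : ∀ τ, 0 ≤ u τ) (h : stabMean (fun τ ↦ (u τ : ℂ)) = 0) : u = 0 := by
  have := hu.finiteIndex
  have := Fintype.ofFinite (SL(2, ℤ) ⧸ modStab fun τ ↦ (u τ : ℂ))
  have h_index : ((modStab fun τ ↦ (u τ : ℂ)).index : ℂ)⁻¹ ≠ 0 :=
    inv_ne_zero (Nat.cast_ne_zero.mpr hu.finiteIndex.index_ne_zero)
  have h_sum : ∑ s : SL(2, ℤ) ⧸ modStab fun τ ↦ (u τ : ℂ),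
      ∫ τ in 𝒟, u ((Quotient.out s)⁻¹ • τ) = 0 := by
    have h' := (mul_eq_zero.mp h).resolve_left h_index
    simp only [finsum_eq_sum_of_fintype, integral_complex_ofReal] at h'
    exact_mod_cast h'
  have h_int (γ : SL(2, ℤ)) : ∫ τ in 𝒟, u (γ • τ) = 0 := by
    have h' := (Finset.sum_eq_zero_iff_of_nonneg
      fun _ _ ↦ integral_nonneg fun _ ↦ hu_nonneg _).mp h_sum ↑γ⁻¹ (Finset.mem_univ _)
    rw [← h']
    congr 1
    ext τ
    simpa using (apply_out_inv_smul (φ := fun τ ↦ (u τ : ℂ)) le_rfl γ⁻¹ τ).symm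
  have h_zero : (fun τ ↦ (u τ : ℂ)) = 0 := eq_zero_of_ae_eq_zero_on_fd hu.continuous fun γ ↦ by
    have h_ae := (integral_eq_zero_iff_of_nonneg (fun _ ↦ hu_nonneg _)
      (hu.integrableOn_comp_smul_fd γ).re).mp (h_int γ)
    filter_upwards [h_ae] with τ hτ
    exact_mod_cast hτ
  ext τ
  simpa using congrFun h_zero τ

/-- The quotient of the normalization `x ^ (k / 2)` of `slash` and the normalization
`x ^ (k - 1)` of Mathlib's slash operator, for matrices of determinant `x > 0`. -/
def slashFactor (k : ℤ) (x : ℝ) : ℝ := x ^ ((k : ℝ) / 2) * x ^ (1 - k)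

lemma slashFactor_one (k : ℤ) : slashFactor k 1 = 1 := by simp [slashFactor]

lemma slashFactor_mul (k : ℤ) {x y : ℝ} (hx : 0 ≤ x) (hy : 0 ≤ y) :
    slashFactor k (x * y) = slashFactor k x * slashFactor k y := by
  rw [slashFactor, slashFactor, slashFactor, Real.mul_rpow hx hy, mul_zpow]
  ring

lemma sq_rpow_div_two {x : ℝ} (hx : 0 ≤ x) (k : ℤ) : (x ^ 2) ^ ((k : ℝ) / 2) = x ^ k := by
  rw [← Real.rpow_natCast, ← Real.rpow_mul hx, ← Real.rpow_intCast]
  congr 1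
  push_cast
  ring

lemma slashFactor_sq (k : ℤ) {x : ℝ} (hx : 0 < x) : slashFactor k x ^ 2 * x ^ (k - 2) = 1 := by
  have h_sq : (x ^ ((k : ℝ) / 2)) ^ 2 = x ^ k := by
    rw [← sq_rpow_div_two hx.le, ← Real.rpow_pow_comm hx.le]
  rw [slashFactor, mul_pow, h_sq, ← zpow_natCast, ← zpow_mul, ← zpow_add₀ hx.ne',
    ← zpow_add₀ hx.ne']
  exact (congrArg (x ^ ·) (by push_cast; ring : k + (1 - k) * ((2 : ℕ) : ℤ) + (k - 2) = 0)).trans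
    (zpow_zero x)

section Slash

variable (k : ℤ) (f : ℍ → ℂ) {A B : GL (Fin 2) ℝ}

lemma slash_eq_smul (hA : 0 < A.det.val) :
    slash k f A = (slashFactor k A.det.val : ℂ) • f ∣[k] A := by
  ext τ
  have h_det : (A.det.val : ℂ) ^ (1 - k) * (A.det.val : ℂ) ^ (k - 1) = 1 := by
    rw [← zpow_add₀ (by exact_mod_cast hA.ne')]; simp
  simp only [slash, slashFactor, ModularForm.slash_apply, Pi.smul_apply, smul_eq_mul, σ, if_pos hA,
    abs_of_pos hA, Complex.ofReal_mul, Complex.ofReal_zpow, ContinuousAlgEquiv.refl_apply]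
  linear_combination
    (-((A.det.val ^ ((k : ℝ) / 2) : ℝ) : ℂ) * denom A τ ^ (-k) * f (A • τ)) * h_det

lemma slash_mul (hA : 0 < A.det.val) (hB : 0 < B.det.val) :
    slash k f (A * B) = slash k (slash k f A) B := by
  have hAB : 0 < (A * B).det.val := by rw [map_mul, Units.val_mul]; positivity
  rw [slash_eq_smul k f hAB, slash_eq_smul k _ hB, slash_eq_smul k f hA, SlashAction.slash_mul,
    ModularForm.smul_slash, σ, if_pos hB, smul_smul, map_mul, Units.val_mul,
    slashFactor_mul k hA.le hB.le]
  simp [mul_comm]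

lemma slash_mapGL (γ : SL(2, ℤ)) : slash k f (mapGL ℝ γ) = f ∣[k] γ := by
  rw [slash_eq_smul k f (by simp), ModularForm.SL_slash]
  simp [slashFactor_one]
  rfl

lemma slash_smul (c : ℂ) (A : GL (Fin 2) ℝ) : slash k (c • f) A = c • slash k f A := by
  ext τ; simp only [slash, Pi.smul_apply, smul_eq_mul]; ring

lemma slash_of_val_eq_scalar {r : ℝ} (hr : 0 < r) (hA : A.val = !![r, 0; 0, r]) :
    slash k f A = f := by
  have h_det : A.det.val = r ^ 2 := by
    rw [Matrix.GeneralLinearGroup.val_det_apply, hA, Matrix.det_fin_two_of]; ring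
  have hr₀ : (r : ℂ) ≠ 0 := by exact_mod_cast hr.ne'
  ext τ
  have h_denom : denom A τ = r := by simp [denom, hA]
  have h_smul : A • τ = τ := by
    ext1
    rw [coe_smul_of_det_pos (by rw [h_det]; positivity), h_denom]
    simp [num, hA, hr₀]
  rw [slash, h_det, sq_rpow_div_two hr.le, h_denom, h_smul, zpow_neg, Complex.ofReal_zpow,
    mul_inv_cancel₀ (zpow_ne_zero _ hr₀), one_mul]

lemma petersson_slash_of_det_pos (g : ℍ → ℂ) (hA : 0 < A.det.val) (τ : ℍ) :
    petersson k (slash k g A) (slash k f A) τ = petersson k g f (A • τ) := by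
  have h_factor : (slashFactor k A.det.val : ℂ) ^ 2 * (A.det.val : ℂ) ^ (k - 2) = 1 := by
    exact_mod_cast slashFactor_sq k hA
  have h_slash := petersson_slash k g f A τ
  rw [σ, if_pos hA, abs_of_pos hA] at h_slash
  calc petersson k (slash k g A) (slash k f A) τ
      = (slashFactor k A.det.val : ℂ) ^ 2 * petersson k (g ∣[k] A) (f ∣[k] A) τ := by
        rw [slash_eq_smul k f hA, slash_eq_smul k g hA]
        simp only [petersson, Pi.smul_apply, smul_eq_mul, map_mul, Complex.conj_ofReal]
        ring
    _ = petersson k g f (A • τ) := by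
        rw [h_slash, ← mul_assoc, h_factor, one_mul]
        rfl

variable {k f}

lemma slash_slash_SL (hA : 0 < A.det.val) (hB : 0 < B.det.val) {γ γ' : SL(2, ℤ)}
    (hf : f ∣[k] γ' = f) (h : A.val * (mapGL ℝ γ).val = (mapGL ℝ γ').val * B.val) :
    slash k f A ∣[k] γ = slash k f B := by
  have h_eq : A * mapGL ℝ γ = mapGL ℝ γ' * B := Units.ext h
  rw [← slash_mapGL, ← slash_mul k f hA (by simp), h_eq, slash_mul k f (by simp) hB, slash_mapGL,
    hf]

end Slash

/-- The rational matrices of positive determinant. -/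
def ratGLPos : Subgroup (GL (Fin 2) ℝ) := ratGL ⊓ Matrix.GLPos (Fin 2) ℝ

lemma mem_ratGLPos_of_val {A : GL (Fin 2) ℝ} {a b c d : ℚ} (h_det : 0 < a * d - b * c)
    (hA : A.val = !![(a : ℝ), (b : ℝ); (c : ℝ), (d : ℝ)]) : A ∈ ratGLPos := by
  refine ⟨⟨Matrix.GeneralLinearGroup.mkOfDetNeZero !![a, b; c, d]
    (by rw [Matrix.det_fin_two_of]; exact h_det.ne'), Units.ext ?_⟩, ?_⟩
  · rw [hA]
    ext i j
    fin_cases i <;> fin_cases j <;> simp [Matrix.GeneralLinearGroup.mkOfDetNeZero]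
  · change 0 < A.det.val
    rw [Matrix.GeneralLinearGroup.val_det_apply, hA, Matrix.det_fin_two_of]
    exact_mod_cast h_det

lemma mapGL_val (γ : SL(2, ℤ)) :
    (mapGL ℝ γ).val = !![(γ 0 0 : ℝ), (γ 0 1 : ℝ); (γ 1 0 : ℝ), (γ 1 1 : ℝ)] := by
  ext i j; fin_cases i <;> fin_cases j <;> simp

lemma det_entries (γ : SL(2, ℤ)) : γ 0 0 * γ 1 1 - γ 0 1 * γ 1 0 = 1 := by
  rw [← Matrix.det_fin_two, γ.det_coe]

lemma matV_val (d : ℕ+) : (matV d).val = !![(d : ℝ), 0; 0, 1] := rfl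

lemma matB_val (b : ℕ) (d : ℕ+) : (matB b d).val = !![1, (b : ℝ); 0, (d : ℝ)] := rfl

lemma matW_val (d : ℕ+) : (matW d).val = !![0, -1; (d : ℝ), 0] := rfl

lemma mapGL_mem_ratGLPos (γ : SL(2, ℤ)) : mapGL ℝ γ ∈ ratGLPos :=
  mem_ratGLPos_of_val (a := γ 0 0) (b := γ 0 1) (c := γ 1 0) (d := γ 1 1)
    (by exact_mod_cast (det_entries γ).symm ▸ one_pos) (by rw [mapGL_val]; simp)

lemma matV_mem_ratGLPos (d : ℕ+) : matV d ∈ ratGLPos :=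
  mem_ratGLPos_of_val (a := d) (b := 0) (c := 0) (d := 1) (by simp) (by simp [matV_val])

lemma matB_mem_ratGLPos (b : ℕ) (d : ℕ+) : matB b d ∈ ratGLPos :=
  mem_ratGLPos_of_val (a := 1) (b := b) (c := 0) (d := d) (by simp) (by simp [matB_val])

lemma matW_mem_ratGLPos (d : ℕ+) : matW d ∈ ratGLPos :=
  mem_ratGLPos_of_val (a := 0) (b := -1) (c := d) (d := 0) (by simp) (by simp [matW_val])

lemma det_pos_matV (d : ℕ+) : 0 < (matV d).det.val := (matV_mem_ratGLPos d).2

lemma det_pos_matB (b : ℕ) (d : ℕ+) : 0 < (matB b d).det.val := (matB_mem_ratGLPos b d).2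

lemma det_pos_matW (d : ℕ+) : 0 < (matW d).det.val := (matW_mem_ratGLPos d).2

lemma slash_matV_one (k : ℤ) (f : ℍ → ℂ) : slash k f (matV 1) = f :=
  slash_of_val_eq_scalar k f one_pos (by simp [matV_val])

lemma slash_matV_mul (k : ℤ) (f : ℍ → ℂ) (d e : ℕ+) :
    slash k f (matV (d * e)) = slash k (slash k f (matV d)) (matV e) := by
  rw [← slash_mul k f (det_pos_matV d) (det_pos_matV e)]
  congr 1
  refine Units.ext ?_
  rw [Units.val_mul, matV_val, matV_val, matV_val]
  simp

lemma slash_matB_zero_matV (k : ℤ) (f : ℍ → ℂ) (d : ℕ+) :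
    slash k (slash k f (matB 0 d)) (matV d) = f := by
  rw [← slash_mul k f (det_pos_matB 0 d) (det_pos_matV d)]
  refine slash_of_val_eq_scalar k f (r := d) (by simp) ?_
  rw [Units.val_mul, matV_val, matB_val]
  simp

/-- A cusp form, viewed on a smaller group. -/
def restrictForm {𝒢 ℋ : Subgroup (GL (Fin 2) ℝ)} {k : ℤ} (h : ℋ ≤ 𝒢) (F : CuspForm 𝒢 k) :
    CuspForm ℋ k where
  toFun := F
  slash_action_eq' γ hγ := F.slash_action_eq' γ (h hγ)
  holo' := F.holo'
  zero_at_cusps' hc := F.zero_at_cusps' (hc.mono h)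

lemma exists_cuspForm_inf {Γ Γ' : Subgroup SL(2, ℤ)} {k : ℤ} (F : CuspForm (Γ.map (mapGL ℝ)) k)
    (G : CuspForm (Γ'.map (mapGL ℝ)) k) :
    ∃ F' G' : CuspForm ((Γ ⊓ Γ').map (mapGL ℝ)) k, (F' : ℍ → ℂ) = F ∧ (G' : ℍ → ℂ) = G :=
  ⟨restrictForm (Subgroup.map_mono inf_le_left) F,
    restrictForm (Subgroup.map_mono inf_le_right) G, rfl, rfl⟩

/-- The space of cusp forms of weight `k` for arbitrary finite index subgroups of the modular
group. -/
def cuspForms (k : ℤ) : Submodule ℂ (ℍ → ℂ) where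
  carrier := {f | ∃ Γ : Subgroup SL(2, ℤ), Γ.FiniteIndex ∧
    ∃ F : CuspForm (Γ.map (mapGL ℝ)) k, (F : ℍ → ℂ) = f}
  zero_mem' := ⟨⊤, inferInstance, 0, rfl⟩
  add_mem' := by
    rintro _ _ ⟨Γ, hΓ, F, rfl⟩ ⟨Γ', hΓ', G, rfl⟩
    obtain ⟨F', G', hF, hG⟩ := exists_cuspForm_inf F G
    exact ⟨Γ ⊓ Γ', inferInstance, F' + G', by rw [FunLike.coe_add, hF, hG]⟩
  smul_mem' := by
    rintro c _ ⟨Γ, hΓ, F, rfl⟩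
    exact ⟨Γ, hΓ, c • F, rfl⟩

section CuspForms

variable {k : ℤ} {f g : ℍ → ℂ}

lemma coe_mem_cuspForms {𝒢 : Subgroup (GL (Fin 2) ℝ)} [𝒢.IsArithmetic] (F : CuspForm 𝒢 k) :
    (F : ℍ → ℂ) ∈ cuspForms k :=
  ⟨𝒢.comap (mapGL ℝ), inferInstance, restrictForm (Subgroup.map_comap_le _ _) F, rfl⟩

lemma slash_mem_cuspForms (hf : f ∈ cuspForms k) {A : GL (Fin 2) ℝ} (hA : A ∈ ratGLPos) :
    slash k f A ∈ cuspForms k := by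
  obtain ⟨Γ, hΓ, F, rfl⟩ := hf
  obtain ⟨β, hβ⟩ := ratGL.inv_mem hA.1
  have : (ConjAct.toConjAct A⁻¹ • Γ.map (mapGL ℝ)).IsArithmetic :=
    hβ ▸ Subgroup.IsArithmetic.conj _ β
  rw [slash_eq_smul k _ hA.2]
  exact (cuspForms k).smul_mem _ (coe_mem_cuspForms (CuspForm.translate F A))

lemma continuous_of_mem_cuspForms (hf : f ∈ cuspForms k) : Continuous f := by
  obtain ⟨Γ, _, F, rfl⟩ := hf
  exact F.holo'.continuous

lemma exists_cuspForm_of_invariant (hf : f ∈ cuspForms k) {Γ : Subgroup SL(2, ℤ)} [Γ.FiniteIndex]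
    (h : ∀ γ ∈ Γ, f ∣[k] γ = f) : ∃ F : CuspForm (Γ.map (mapGL ℝ)) k, (F : ℍ → ℂ) = f := by
  obtain ⟨Γ', hΓ', F, rfl⟩ := hf
  exact ⟨
    { toFun := F
      slash_action_eq' := by rintro _ ⟨γ, hγ, rfl⟩; exact h γ hγ
      holo' := F.holo'
      zero_at_cusps' := fun hc ↦ F.zero_at_cusps' <|
        (Subgroup.IsArithmetic.isCusp_iff_isCusp_SL2Z _).mpr <|
        (Subgroup.IsArithmetic.isCusp_iff_isCusp_SL2Z _).mp hc }, rfl⟩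

lemma isModularFunction_petersson (hf : f ∈ cuspForms k) (hg : g ∈ cuspForms k) :
    IsModularFunction (petersson k g f) where
  continuous :=
    petersson_continuous k (continuous_of_mem_cuspForms hg) (continuous_of_mem_cuspForms hf)
  bounded := by
    obtain ⟨⟨Γ, hΓ, F, rfl⟩, Γ', hΓ', G, rfl⟩ := And.intro hf hg
    obtain ⟨F', G', hF, hG⟩ := exists_cuspForm_inf F G
    rw [← hF, ← hG]
    exact CuspFormClass.petersson_bounded_left k ((Γ ⊓ Γ').map (mapGL ℝ)) G' F'
  finiteIndex := by
    obtain ⟨⟨Γ, hΓ, F, rfl⟩, Γ', hΓ', G, rfl⟩ := And.intro hf hg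
    obtain ⟨F', G', hF, hG⟩ := exists_cuspForm_inf F G
    rw [← hF, ← hG]
    exact Subgroup.finiteIndex_of_le (H := Γ ⊓ Γ') fun γ hγ τ ↦
      SlashInvariantFormClass.petersson_smul (Γ := (Γ ⊓ Γ').map (mapGL ℝ)) ⟨γ, hγ, rfl⟩

end CuspForms

/-- The Petersson inner product of weight `k`, normalized so as not to depend on the level. -/
def petInner (k : ℤ) (f g : ℍ → ℂ) : ℂ := stabMean (petersson k g f)

section PetInner

variable {k : ℤ} {f g : ℍ → ℂ}

lemma pet_eq_petInner {Γ : Subgroup SL(2, ℤ)} [Γ.FiniteIndex] (hf : ∀ γ ∈ Γ, f ∣[k] γ = f)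
    (hg : ∀ γ ∈ Γ, g ∣[k] γ = g) : pet Γ k f g = petInner k f g :=
  mean_eq_stabMean fun γ hγ τ ↦ by rw [← petersson_slash_SL, hf γ hγ, hg γ hγ]

lemma petInner_add_left {f₁ f₂ : ℍ → ℂ} (h₁ : f₁ ∈ cuspForms k) (h₂ : f₂ ∈ cuspForms k)
    (hg : g ∈ cuspForms k) : petInner k (f₁ + f₂) g = petInner k f₁ g + petInner k f₂ g := by
  rw [petInner, petInner, petInner, ← (isModularFunction_petersson h₁ hg).stabMean_add
    (isModularFunction_petersson h₂ hg)]
  congr 1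
  ext τ
  simp only [petersson, Pi.add_apply]
  ring

lemma petInner_smul_left (hf : f ∈ cuspForms k) (hg : g ∈ cuspForms k) (c : ℂ) :
    petInner k (c • f) g = c * petInner k f g := by
  rw [petInner, petInner, ← (isModularFunction_petersson hf hg).stabMean_smul c]
  congr 1
  ext τ
  simp only [petersson, Pi.smul_apply, smul_eq_mul]
  ring

lemma petInner_sum_left {ι : Type*} (s : Finset ι) {F : ι → ℍ → ℂ} (hF : ∀ i, F i ∈ cuspForms k)
    (hg : g ∈ cuspForms k) : petInner k (∑ i ∈ s, F i) g = ∑ i ∈ s, petInner k (F i) g := by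
  classical
  induction s using Finset.induction_on with
  | empty => simpa using petInner_smul_left (zero_mem (cuspForms k)) hg 0
  | insert i s hi ih =>
    rw [Finset.sum_insert hi, Finset.sum_insert hi,
      petInner_add_left (hF i) (sum_mem fun j _ ↦ hF j) hg, ih]

lemma petInner_slash (hf : f ∈ cuspForms k) (hg : g ∈ cuspForms k) {A : GL (Fin 2) ℝ}
    (hA : A ∈ ratGLPos) : petInner k (slash k f A) (slash k g A) = petInner k f g := by
  rw [petInner, petInner, ← (isModularFunction_petersson hf hg).stabMean_comp_smul hA.1]
  exact congrArg stabMean (funext (petersson_slash_of_det_pos k f g hA.2))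

lemma petInner_slash_SL (hf : f ∈ cuspForms k) (hg : g ∈ cuspForms k) (γ : SL(2, ℤ)) :
    petInner k (f ∣[k] γ) (g ∣[k] γ) = petInner k f g := by
  rw [← slash_mapGL, ← slash_mapGL]
  exact petInner_slash hf hg (mapGL_mem_ratGLPos γ)

lemma petInner_slash_matB_zero (hf : f ∈ cuspForms k) (hg : g ∈ cuspForms k) (d : ℕ+) :
    petInner k (slash k f (matB 0 d)) g = petInner k f (slash k g (matV d)) := by
  rw [← petInner_slash (slash_mem_cuspForms hf (matB_mem_ratGLPos 0 d)) hg (matV_mem_ratGLPos d),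
    slash_matB_zero_matV]

lemma eq_zero_of_petInner_self (hf : f ∈ cuspForms k) (h : petInner k f f = 0) : f = 0 := by
  have h_norm : petersson k f f = fun τ ↦ ((‖f τ‖ ^ 2 * τ.im ^ k : ℝ) : ℂ) := by
    ext τ
    simp only [petersson, Complex.conj_mul']
    push_cast
    rfl
  have h_mod := isModularFunction_petersson hf hf
  rw [petInner, h_norm] at h
  rw [h_norm] at h_mod
  have h_zero := eq_zero_of_stabMean_eq_zero h_mod
    (fun τ ↦ mul_nonneg (sq_nonneg _) (zpow_nonneg τ.im_pos.le k)) h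
  ext τ
  simpa [zpow_ne_zero k τ.im_ne_zero] using congrFun h_zero τ

end PetInner

/-- The operator `U(d)` in its unitary normalization, `U(d) f = ∑_{0 ≤ b < d} f | (1 b; 0 d)`. -/
def opU (k : ℤ) (d : ℕ+) (f : ℍ → ℂ) : ℍ → ℂ := ∑ b ∈ Finset.range d, slash k f (matB b d)

lemma opU_eq_sum_zmod (k : ℤ) (d : ℕ+) (f : ℍ → ℂ) :
    opU k d f = ∑ x : ZMod d, slash k f (matB x.val d) :=
  Finset.sum_nbij' (fun b ↦ (b : ZMod d)) ZMod.val (by simp) (by simp [ZMod.val_lt])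
    (fun b hb ↦ ZMod.val_cast_of_lt (Finset.mem_range.mp hb)) (by simp)
    fun b hb ↦ by rw [ZMod.val_cast_of_lt (Finset.mem_range.mp hb)]

lemma mem_Gamma0_iff_dvd {N : ℕ} {γ : SL(2, ℤ)} : γ ∈ Gamma0 N ↔ (N : ℤ) ∣ γ 1 0 := by
  rw [Gamma0_mem, ZMod.intCast_zmod_eq_zero_iff_dvd]

lemma T_mem_Gamma0 (N : ℕ) : ModularGroup.T ∈ Gamma0 N :=
  mem_Gamma0_iff_dvd.mpr (by simp [ModularGroup.T])

lemma slash_eq_self_of_S_of_T {k : ℤ} {f : ℍ → ℂ} (hS : f ∣[k] ModularGroup.S = f)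
    (hT : f ∣[k] ModularGroup.T = f) (γ : SL(2, ℤ)) : f ∣[k] γ = f := by
  have hγ : γ ∈ Subgroup.closure {ModularGroup.S, ModularGroup.T} := by
    simp [SpecialLinearGroup.SL2Z_generators]
  induction hγ using Subgroup.closure_induction with
  | mem γ hγ =>
    rcases hγ with rfl | rfl
    exacts [hS, hT]
  | one => simp
  | mul γ δ _ _ hγ hδ => rw [SlashAction.slash_mul, hγ, hδ]
  | inv γ _ hγ =>
    nth_rw 1 [← hγ]
    rw [← SlashAction.slash_mul]
    simp

lemma slash_matB_zero_S (k : ℤ) (f : ℍ → ℂ) (d : ℕ+) :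
    slash k f (matB 0 d) ∣[k] ModularGroup.S = slash k f (matW d) :=
  slash_slash_SL (γ' := 1) (det_pos_matB 0 d) (det_pos_matW d) (by simp) (by
    rw [mapGL_val, mapGL_val, matB_val, matW_val]; simp [ModularGroup.S])

lemma slash_matB_T (k : ℤ) (f : ℍ → ℂ) (b : ℕ) (d : ℕ+) :
    slash k f (matB b d) ∣[k] ModularGroup.T = slash k f (matB (b + 1) d) :=
  slash_slash_SL (γ' := 1) (det_pos_matB b d) (det_pos_matB _ d) (by simp) (by
    rw [mapGL_val, mapGL_val, matB_val, matB_val]; simp [ModularGroup.T, add_comm])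

section Level

variable {k : ℤ} {f : ℍ → ℂ} {N : ℕ} (hf : ∀ γ ∈ Gamma0 N, f ∣[k] γ = f) (d : ℕ+)
include hf

lemma slash_matV_invariant {γ : SL(2, ℤ)} (hγ : γ ∈ Gamma0 (d * N)) :
    slash k f (matV d) ∣[k] γ = slash k f (matV d) := by
  obtain ⟨c, hc⟩ := mem_Gamma0_iff_dvd.mp hγ
  push_cast at hc
  let γ' : SL(2, ℤ) := ⟨!![γ 0 0, d * γ 0 1; N * c, γ 1 1], by
    rw [Matrix.det_fin_two_of]; linear_combination det_entries γ + γ 0 1 * hc⟩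
  refine slash_slash_SL (γ' := γ') (det_pos_matV d) (det_pos_matV d)
    (hf γ' (mem_Gamma0_iff_dvd.mpr ⟨c, rfl⟩)) ?_
  have hcR : (γ 1 0 : ℝ) = d * N * c := by exact_mod_cast hc
  rw [mapGL_val, mapGL_val, matV_val]
  ext i j
  fin_cases i <;> fin_cases j <;> simp [γ', hcR, mul_assoc, mul_comm]

lemma slash_matB_slash {γ : SL(2, ℤ)} (hγ : (N : ℤ) ∣ d * γ 1 0) {x y : ZMod d}
    (hxy : (γ 0 1 : ZMod d) + x * γ 1 1 = y * (γ 0 0 + x * γ 1 0)) :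
    slash k f (matB x.val d) ∣[k] γ = slash k f (matB y.val d) := by
  obtain ⟨b, hb⟩ : (d : ℤ) ∣
      γ 0 1 + x.val * γ 1 1 - y.val * (γ 0 0 + x.val * γ 1 0) := by
    refine (ZMod.intCast_zmod_eq_zero_iff_dvd _ d).mp ?_
    push_cast
    rw [ZMod.natCast_zmod_val, ZMod.natCast_zmod_val, hxy, sub_self]
  let γ' : SL(2, ℤ) :=
    ⟨!![γ 0 0 + x.val * γ 1 0, b; d * γ 1 0, γ 1 1 - y.val * γ 1 0], by
      rw [Matrix.det_fin_two_of]; linear_combination det_entries γ + γ 1 0 * hb⟩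
  refine slash_slash_SL (γ' := γ') (det_pos_matB _ d) (det_pos_matB _ d)
    (hf γ' (mem_Gamma0_iff_dvd.mpr hγ)) ?_
  have hbR : (γ 0 1 + x.val * γ 1 1 - y.val * (γ 0 0 + x.val * γ 1 0) : ℝ) = d * b := by
    exact_mod_cast hb
  rw [mapGL_val, mapGL_val, matB_val, matB_val]
  ext i j
  fin_cases i <;> fin_cases j <;> simp [γ', Matrix.mul_apply, -ZMod.natCast_val]
  · linear_combination hbR
  · ring

lemma opU_invariant {γ : SL(2, ℤ)} (hd : (d : ℤ) ∣ γ 1 0) (hN : (N : ℤ) ∣ d * γ 1 0) :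
    opU k d f ∣[k] γ = opU k d f := by
  have h_zero : (γ 1 0 : ZMod d) = 0 := (ZMod.intCast_zmod_eq_zero_iff_dvd _ d).mpr hd
  have h_det : (γ 0 0 : ZMod d) * γ 1 1 = 1 := by
    have h := congrArg (Int.cast (R := ZMod d)) (det_entries γ)
    push_cast at h
    rwa [h_zero, mul_zero, sub_zero] at h
  let e : ZMod d ≃ ZMod d :=
    { toFun := fun x ↦ γ 1 1 * (γ 0 1 + x * γ 1 1)
      invFun := fun y ↦ γ 0 0 * (γ 0 0 * y - γ 0 1)
      left_inv := fun x ↦ by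
        linear_combination (γ 0 0 * γ 0 1 + x * (γ 0 0 * γ 1 1 + 1)) * h_det
      right_inv := fun y ↦ by
        linear_combination (y * (γ 0 0 * γ 1 1 + 1) - γ 1 1 * γ 0 1) * h_det }
  rw [opU_eq_sum_zmod, SlashAction.sum_slash]
  refine Fintype.sum_equiv e _ _ fun x ↦ slash_matB_slash hf d hN ?_
  change _ = γ 1 1 * (γ 0 1 + x * γ 1 1) * (γ 0 0 + x * γ 1 0)
  rw [h_zero]
  linear_combination -(γ 0 1 + x * γ 1 1) * h_det

lemma opU_invariant_of_dvd {M : ℕ} (hd : (d : ℕ) ∣ M) (hN : N ∣ d * M) {γ : SL(2, ℤ)}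
    (hγ : γ ∈ Gamma0 M) : opU k d f ∣[k] γ = opU k d f := by
  have hγ := mem_Gamma0_iff_dvd.mp hγ
  refine opU_invariant hf d ((Int.natCast_dvd_natCast.mpr hd).trans hγ)
    ((Int.natCast_dvd_natCast.mpr hN).trans ?_)
  push_cast
  exact mul_dvd_mul_left _ hγ

lemma opU_T : opU k d f ∣[k] ModularGroup.T = opU k d f :=
  opU_invariant hf d (by simp [ModularGroup.T]) (by simp [ModularGroup.T])

lemma exists_slash_matV_slash_eq_slash_matB_zero (hd : (d : ℕ).Coprime N) :
    ∃ γ ∈ Gamma0 N, slash k f (matV d) ∣[k] γ = slash k f (matB 0 d) := by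
  obtain ⟨a, b, hab⟩ := Nat.isCoprime_iff_coprime.mpr hd
  let γ : SL(2, ℤ) := ⟨!![1, -b; N, d * a], by
    rw [Matrix.det_fin_two_of]; linear_combination hab⟩
  let γ' : SL(2, ℤ) := ⟨!![d, -b; N, a], by
    rw [Matrix.det_fin_two_of]; linear_combination hab⟩
  refine ⟨γ, mem_Gamma0_iff_dvd.mpr dvd_rfl, slash_slash_SL (γ' := γ') (det_pos_matV d)
    (det_pos_matB 0 d) (hf γ' (mem_Gamma0_iff_dvd.mpr dvd_rfl)) ?_⟩
  rw [mapGL_val, mapGL_val, matV_val, matB_val]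
  simp [γ, γ', mul_comm]

end Level

section Adjoint

variable {k : ℤ} {f g : ℍ → ℂ}

lemma opU_mem_cuspForms (hf : f ∈ cuspForms k) (d : ℕ+) : opU k d f ∈ cuspForms k :=
  sum_mem fun b _ ↦ slash_mem_cuspForms hf (matB_mem_ratGLPos b d)

lemma petInner_slash_matB (hf : f ∈ cuspForms k) (hg : g ∈ cuspForms k)
    (hT : g ∣[k] ModularGroup.T = g) (b : ℕ) (d : ℕ+) :
    petInner k (slash k f (matB b d)) g = petInner k f (slash k g (matV d)) := by
  induction b with
  | zero => exact petInner_slash_matB_zero hf hg d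
  | succ b ih =>
    rw [← ih, ← slash_matB_T]
    nth_rw 1 [← hT]
    exact petInner_slash_SL (slash_mem_cuspForms hf (matB_mem_ratGLPos b d)) hg _

lemma petInner_opU (hf : f ∈ cuspForms k) (hg : g ∈ cuspForms k)
    (hT : g ∣[k] ModularGroup.T = g) (d : ℕ+) :
    petInner k (opU k d f) g = d * petInner k f (slash k g (matV d)) := by
  rw [opU, petInner_sum_left _ (fun b ↦ slash_mem_cuspForms hf (matB_mem_ratGLPos b d)) hg]
  simp [petInner_slash_matB hf hg hT]

variable {N : ℕ}

lemma slash_matV_T (hN : ∀ γ ∈ Gamma0 N, f ∣[k] γ = f) (d : ℕ+) :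
    slash k f (matV d) ∣[k] ModularGroup.T = slash k f (matV d) :=
  slash_matV_invariant hN d (T_mem_Gamma0 _)

lemma petInner_slash_matV_pow_of_opU_eq (hf : f ∈ cuspForms k)
    (hN : ∀ γ ∈ Gamma0 N, f ∣[k] γ = f) {d : ℕ+} {μ : ℂ} (hU : opU k d f = μ • f) (l : ℕ) :
    petInner k f (slash k f (matV (d ^ l))) = (μ / d) ^ l * petInner k f f := by
  induction l with
  | zero => rw [pow_zero, slash_matV_one, pow_zero, one_mul]
  | succ l ih =>
    have h_mem := slash_mem_cuspForms hf (matV_mem_ratGLPos (d ^ l))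
    have h_adj := petInner_opU hf h_mem (slash_matV_T hN _) d
    rw [hU, petInner_smul_left hf h_mem, ih, ← slash_matV_mul, ← pow_succ] at h_adj
    have hd : (d : ℂ) ≠ 0 := by simp
    rw [← mul_right_inj' hd, ← h_adj, pow_succ]
    field_simp

/-- The ratio `⟨f, f | V(q ^ l)⟩ / ⟨f, f⟩` for a form `f` of level prime to `q` with
`U(q) f + f | V(q) = μ f`, as a function of `l`. -/
def petRatio (q μ : ℂ) : ℕ → ℂ
  | 0 => 1
  | 1 => μ / (q + 1)
  | l + 2 => (μ * petRatio q μ (l + 1) - petRatio q μ l) / q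

lemma petInner_slash_matV_left (hf : f ∈ cuspForms k) (hN : ∀ γ ∈ Gamma0 N, f ∣[k] γ = f) {d : ℕ+}
    (hd : (d : ℕ).Coprime N) :
    petInner k (slash k f (matV d)) f = petInner k f (slash k f (matV d)) := by
  obtain ⟨γ, hγ, h_slash⟩ := exists_slash_matV_slash_eq_slash_matB_zero hN d hd
  rw [← petInner_slash_SL (slash_mem_cuspForms hf (matV_mem_ratGLPos d)) hf γ, h_slash, hN γ hγ,
    petInner_slash_matB_zero hf hf]

lemma petInner_slash_matV_pow_of_opU_add_eq (hf : f ∈ cuspForms k)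
    (hN : ∀ γ ∈ Gamma0 N, f ∣[k] γ = f) {d : ℕ+} (hd : (d : ℕ).Coprime N) {μ : ℂ}
    (hU : opU k d f + slash k f (matV d) = μ • f) (l : ℕ) :
    petInner k f (slash k f (matV (d ^ l))) = petRatio d μ l * petInner k f f := by
  have h_mem (e : ℕ+) := slash_mem_cuspForms hf (matV_mem_ratGLPos e)
  have h_adj {g : ℍ → ℂ} (hg : g ∈ cuspForms k) (hT : g ∣[k] ModularGroup.T = g) :
      d * petInner k f (slash k g (matV d)) + petInner k (slash k f (matV d)) g =
        μ * petInner k f g := by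
    rw [← petInner_opU hf hg hT, ← petInner_add_left (opU_mem_cuspForms hf d) (h_mem d) hg, hU,
      petInner_smul_left hf hg]
  have hd₀ : (d : ℂ) ≠ 0 := by simp
  have hd₁ : (d : ℂ) + 1 ≠ 0 := Nat.cast_add_one_ne_zero (d : ℕ)
  induction l using Nat.twoStepInduction with
  | zero => rw [pow_zero, slash_matV_one, petRatio, one_mul]
  | one =>
    have h := h_adj hf (hN _ (T_mem_Gamma0 N))
    rw [petInner_slash_matV_left hf hN hd] at h
    rw [pow_one, petRatio, div_mul_eq_mul_div, eq_div_iff hd₁]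
    linear_combination h
  | more l ih₀ ih₁ =>
    have h_isom : petInner k (slash k f (matV d)) (slash k f (matV (d ^ (l + 1)))) =
        petInner k f (slash k f (matV (d ^ l))) := by
      rw [pow_succ, slash_matV_mul]
      exact petInner_slash hf (h_mem _) (matV_mem_ratGLPos d)
    have h := h_adj (h_mem (d ^ (l + 1))) (slash_matV_T hN _)
    rw [h_isom, ← slash_matV_mul, ← pow_succ, ih₀, ih₁] at h
    rw [petRatio, div_mul_eq_mul_div, eq_div_iff hd₀]
    linear_combination h

end Adjoint

section QExpansion

open Function.Periodic (qParam)

lemma coe_matV_smul (d : ℕ+) (τ : ℍ) : ((matV d • τ : ℍ) : ℂ) = d * τ := by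
  rw [coe_smul_of_det_pos (det_pos_matV d)]
  simp [num, denom, matV_val]

lemma coe_matB_smul (b : ℕ) (d : ℕ+) (τ : ℍ) : ((matB b d • τ : ℍ) : ℂ) = (τ + b) / d := by
  rw [coe_smul_of_det_pos (det_pos_matB b d)]
  simp [num, denom, matB_val]

lemma slash_matV_apply (k : ℤ) (f : ℍ → ℂ) (d : ℕ+) (τ : ℍ) :
    slash k f (matV d) τ = (((d : ℝ) ^ ((k : ℝ) / 2) : ℝ) : ℂ) * f (matV d • τ) := by
  have h_det : (matV d).det.val = d := by simp [Matrix.GeneralLinearGroup.val_det_apply, matV_val]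
  have h_denom : denom (matV d) τ = 1 := by simp [denom, matV_val]
  rw [slash, h_det, h_denom, one_zpow, mul_one]

lemma slash_matB_apply (k : ℤ) (f : ℍ → ℂ) (b : ℕ) (d : ℕ+) (τ : ℍ) :
    slash k f (matB b d) τ = (((d : ℝ) ^ (-(k : ℝ) / 2) : ℝ) : ℂ) * f (matB b d • τ) := by
  have h_det : (matB b d).det.val = d := by
    simp [Matrix.GeneralLinearGroup.val_det_apply, matB_val]
  have h_denom : denom (matB b d) τ = d := by simp [denom, matB_val]
  have h_exp : (d : ℝ) ^ ((k : ℝ) / 2) * (d : ℝ) ^ (-k) = (d : ℝ) ^ (-(k : ℝ) / 2) := by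
    rw [← Real.rpow_intCast, ← Real.rpow_add (by simp)]
    congr 1
    push_cast
    ring
  rw [slash, h_det, h_denom, ← h_exp]
  push_cast
  rfl

lemma sum_range_pow_pow_of_isPrimitiveRoot {R : Type*} [CommRing R] [IsDomain R] {ζ : R} {d : ℕ}
    (hζ : IsPrimitiveRoot ζ d) (n : ℕ) :
    ∑ b ∈ Finset.range d, (ζ ^ n) ^ b = if d ∣ n then (d : R) else 0 := by
  split_ifs with h
  · simp [(hζ.pow_eq_one_iff_dvd n).mpr h]
  · have h_ne : ζ ^ n - 1 ≠ 0 := sub_ne_zero.mpr (mt (hζ.pow_eq_one_iff_dvd n).mp h)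
    refine (mul_eq_zero.mp ?_).resolve_right h_ne
    rw [geom_sum_mul, pow_right_comm, hζ.pow_eq_one, one_pow, sub_self]

lemma qParam_one_add (z w : ℂ) : qParam 1 (z + w) = qParam 1 z * qParam 1 w := by
  simp only [qParam, ← Complex.exp_add]
  congr 1
  ring

lemma qParam_one_natCast_mul (n : ℕ) (z : ℂ) : qParam 1 (n * z) = qParam 1 z ^ n := by
  simp only [qParam, ← Complex.exp_nat_mul]
  congr 1
  ring

lemma isPrimitiveRoot_qParam_one_inv (d : ℕ+) : IsPrimitiveRoot (qParam 1 (1 / d : ℂ)) d := by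
  convert Complex.isPrimitiveRoot_exp d d.ne_zero using 1
  rw [qParam]
  congr 1
  push_cast
  ring

variable {f : ℍ → ℂ} {a : ℕ → ℂ}

lemma hasSum_slash_matV (hf : ∀ τ : ℍ, HasSum (fun n ↦ a n * qParam 1 τ ^ n) (f τ)) (k : ℤ)
    (d : ℕ+) (τ : ℍ) :
    HasSum (fun n ↦ (((d : ℝ) ^ ((k : ℝ) / 2) : ℝ) : ℂ) *
      (if (d : ℕ) ∣ n then a (n / d) else 0) * qParam 1 τ ^ n) (slash k f (matV d) τ) := by
  have h_inj : Function.Injective ((d : ℕ) * ·) := mul_right_injective₀ d.ne_zero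
  simp only [mul_assoc]
  rw [slash_matV_apply]
  refine HasSum.mul_left _ ((h_inj.hasSum_iff fun n hn ↦ ?_).mp ?_)
  · rw [if_neg fun ⟨m, hm⟩ ↦ hn ⟨m, hm.symm⟩, zero_mul]
  · have h := hf (matV d • τ)
    rw [coe_matV_smul, qParam_one_natCast_mul] at h
    convert! h using 1
    funext n
    simp only [Function.comp_apply, dvd_mul_right, if_pos, Nat.mul_div_cancel_left _ d.pos, pow_mul]

lemma hasSum_opU (hf : ∀ τ : ℍ, HasSum (fun n ↦ a n * qParam 1 τ ^ n) (f τ)) (k : ℤ) (d : ℕ+)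
    (τ : ℍ) :
    HasSum (fun n ↦ (((d : ℝ) ^ (1 - (k : ℝ) / 2) : ℝ) : ℂ) * a (d * n) * qParam 1 τ ^ n)
      (opU k d f τ) := by
  have hd : (d : ℂ) ≠ 0 := by simp
  set q := qParam 1 (τ / d)
  set ζ := qParam 1 (1 / d : ℂ)
  have hζ : IsPrimitiveRoot ζ d := isPrimitiveRoot_qParam_one_inv d
  have hq : q ^ (d : ℕ) = qParam 1 τ := by
    rw [← qParam_one_natCast_mul, mul_div_cancel₀ _ hd]
  have h_term (b : ℕ) : HasSum (fun n ↦ a n * q ^ n * (ζ ^ n) ^ b) (f (matB b d • τ)) := by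
    have h := hf (matB b d • τ)
    rw [coe_matB_smul, add_div, qParam_one_add, ← mul_one_div (b : ℂ), qParam_one_natCast_mul] at h
    simpa only [mul_pow, mul_assoc, pow_right_comm] using h
  have h_sum : HasSum (fun n ↦ a n * q ^ n * if (d : ℕ) ∣ n then (d : ℂ) else 0)
      (∑ b ∈ Finset.range d, f (matB b d • τ)) := by
    simpa only [← Finset.mul_sum, sum_range_pow_pow_of_isPrimitiveRoot hζ] using
      hasSum_sum (s := Finset.range d) fun b _ ↦ h_term b
  replace h_sum := ((mul_right_injective₀ d.ne_zero).hasSum_iff fun n hn ↦ by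
    rw [if_neg fun ⟨m, hm⟩ ↦ hn ⟨m, hm.symm⟩, mul_zero]).mpr h_sum
  have h_exp : (d : ℝ) ^ (1 - (k : ℝ) / 2) = (d : ℝ) ^ (-(k : ℝ) / 2) * d := by
    rw [← Real.rpow_add_one (by simp)]
    ring_nf
  rw [opU, Finset.sum_apply]
  simp only [slash_matB_apply, ← Finset.mul_sum]
  convert! h_sum.mul_left _ using 1
  funext n
  rw [Function.comp_apply, if_pos (dvd_mul_right _ _), pow_mul, hq, h_exp]
  push_cast
  ring

end QExpansion

section Newform

open Function.Periodic (qParam)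

variable {N : ℕ} {k : ℤ} {f : CuspSpace N k}

lemma CuspSpace.slash_eq (f : CuspSpace N k) {γ : SL(2, ℤ)} (hγ : γ ∈ Gamma0 N) :
    (f : ℍ → ℂ) ∣[k] γ = f :=
  f.slash_action_eq' _ ⟨γ, hγ, rfl⟩

lemma Gamma0_le_of_dvd {M N : ℕ} (h : M ∣ N) : Gamma0 N ≤ Gamma0 M := fun _ hγ ↦
  mem_Gamma0_iff_dvd.mpr ((Int.natCast_dvd_natCast.mpr h).trans (mem_Gamma0_iff_dvd.mp hγ))

lemma petV_eq_petInner [NeZero N] (f : CuspSpace N k) (d : ℕ+) :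
    petV N k f d = petInner k f (slash k f (matV d)) :=
  pet_eq_petInner (fun _ hγ ↦ f.slash_eq (Gamma0_le_of_dvd (dvd_mul_left _ _) hγ))
    fun _ hγ ↦ slash_matV_invariant (fun _ ↦ f.slash_eq) d hγ

lemma pet_Gamma0_eq_petInner [NeZero N] (f g : CuspSpace N k) :
    pet (Gamma0 N) k f g = petInner k f g :=
  pet_eq_petInner (fun _ ↦ f.slash_eq) fun _ ↦ g.slash_eq

lemma one_mem_strictPeriods_Gamma0 (N : ℕ) :
    (1 : ℝ) ∈ ((Gamma0 N).map (mapGL ℝ)).strictPeriods := by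
  rw [strictPeriods_Gamma0]
  exact AddSubgroup.mem_zmultiples 1

lemma hasSum_coeff [NeZero N] (f : CuspSpace N k) (τ : ℍ) :
    HasSum (fun n ↦ coeff f n * qParam 1 τ ^ n) (f τ) :=
  ModularForm.hasSum_qExpansion f one_pos (one_mem_strictPeriods_Gamma0 N) τ

lemma eq_mul_coeff_of_hasSum [NeZero N] {c : ℂ} {a : ℕ → ℂ}
    (h : ∀ τ : ℍ, HasSum (fun n ↦ a n * qParam 1 τ ^ n) (c * f τ)) (n : ℕ) :
    a n = c * coeff f n := by
  have h_unique (b : ℕ → ℂ) (hb : ∀ τ : ℍ, HasSum (fun n ↦ b n * qParam 1 τ ^ n) (c * f τ)) :=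
    ModularFormClass.qExpansion_coeff_unique (f := c • f) one_pos
      (one_mem_strictPeriods_Gamma0 N) hb n
  refine (h_unique a h).trans (h_unique (c * coeff f ·) fun τ ↦ ?_).symm
  simpa only [mul_assoc] using! (hasSum_coeff f τ).mul_left c

/-- The Fourier coefficient `a(n) / n ^ (k / 2 - 1)`, normalized so that for a normalized newform
of level prime to `p` the coefficient at `p` is the eigenvalue of `f ↦ U(p) f + f | V(p)`. -/
def normalizedCoeff (k : ℤ) (f : ℍ → ℂ) (n : ℕ) : ℂ :=
  coeff f n / (((n : ℝ) ^ ((k : ℝ) / 2 - 1) : ℝ) : ℂ)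

lemma normalizedCoeff_pow (k : ℤ) (f : ℍ → ℂ) (n l : ℕ) :
    normalizedCoeff k f n ^ l =
      coeff f n ^ l / ((((n : ℝ) ^ l) ^ ((k : ℝ) / 2 - 1) : ℝ) : ℂ) := by
  rw [normalizedCoeff, div_pow, ← Complex.ofReal_pow, Real.rpow_pow_comm n.cast_nonneg]

namespace IsNormalizedNewform

lemma ne_zero (hf : IsNormalizedNewform N k f) : (f : ℍ → ℂ) ≠ 0 := by
  intro h
  have := hf.normalized
  rw [coeff, h, qExpansion_zero] at this
  simp at this

lemma opU_add_eq [NeZero N] (hf : IsNormalizedNewform N k f) {p : ℕ+} (hp : (p : ℕ).Prime) :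
    (opU k p f + if (p : ℕ) ∣ N then 0 else slash k f (matV p)) =
      normalizedCoeff k f p • (f : ℍ → ℂ) := by
  obtain ⟨c, hc⟩ := hf.eigen p hp
  have hr : (((p : ℝ) ^ ((k : ℝ) / 2 - 1) : ℝ) : ℂ) ≠ 0 := by
    exact_mod_cast (Real.rpow_pos_of_pos (by simp) _).ne'
  obtain ⟨μ, hμ⟩ : ∃ μ : ℂ, (opU k p f + if (p : ℕ) ∣ N then 0 else slash k f (matV p)) =
      μ • (f : ℍ → ℂ) := by
    refine ⟨(((p : ℝ) ^ ((k : ℝ) / 2 - 1) : ℝ) : ℂ)⁻¹ * c, ?_⟩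
    rw [mul_smul, ← hc, heckeT, inv_smul_smul₀ hr, opU]
  obtain ⟨b, hb_one, hb⟩ : ∃ b : ℕ → ℂ, b 1 = 0 ∧ ∀ τ : ℍ, HasSum (fun n ↦ b n * qParam 1 τ ^ n)
      ((if (p : ℕ) ∣ N then 0 else slash k f (matV p) : ℍ → ℂ) τ) := by
    split_ifs
    · exact ⟨0, rfl, fun τ ↦ by simp⟩
    · exact ⟨_, by simp [hp.ne_one], hasSum_slash_matV (hasSum_coeff f) k p⟩
  have h_coeff := eq_mul_coeff_of_hasSum (f := f) (c := μ) (fun τ ↦ by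
    have h := (hasSum_opU (hasSum_coeff f) k p τ).add (hb τ)
    rw [← Pi.add_apply, hμ] at h
    simpa only [← add_mul] using! h) 1
  rw [hf.normalized, mul_one, mul_one, hb_one, add_zero] at h_coeff
  rw [hμ, ← h_coeff, normalizedCoeff, ← neg_sub, Real.rpow_neg (Nat.cast_nonneg _)]
  congr 1
  push_cast
  ring

lemma petInner_slash_matV_eq_zero [NeZero N] (hf : IsNormalizedNewform N k f) {g : ℍ → ℂ}
    (hg : g ∈ cuspForms k) {M : ℕ} (hM : M < N) (hgM : ∀ γ ∈ Gamma0 M, g ∣[k] γ = g) {d : ℕ+}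
    (hd : M * d ∣ N) : petInner k f (slash k g (matV d)) = 0 := by
  have : NeZero M := ⟨by rintro rfl; exact NeZero.ne N (by simpa using hd)⟩
  obtain ⟨F, rfl⟩ := exists_cuspForm_of_invariant hg hgM
  rw [← hf.new _ (Submodule.subset_span ⟨M, d, F, hM, hd, rfl⟩)]
  refine (pet_eq_petInner (fun _ ↦ f.slash_eq) fun γ hγ ↦ slash_matV_invariant hgM d ?_).symm
  exact Gamma0_le_of_dvd (mul_comm M d ▸ hd) hγ

lemma not_invariant_of_lt [NeZero N] (hf : IsNormalizedNewform N k f) {M : ℕ} (hM : M < N)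
    (hMN : M ∣ N) : ¬ ∀ γ ∈ Gamma0 M, (f : ℍ → ℂ) ∣[k] γ = f := fun hfM ↦ by
  have h := hf.petInner_slash_matV_eq_zero (coe_mem_cuspForms f) hM hfM (d := 1) (by simpa)
  rw [slash_matV_one] at h
  exact hf.ne_zero (eq_zero_of_petInner_self (coe_mem_cuspForms f) h)

/-- `U(p)` lowers the level from `N` to `N / p` when `p ^ 2 ∣ N`, so a nonzero eigenvalue would
make `f` old. -/
lemma opU_eq_zero [NeZero N] (hf : IsNormalizedNewform N k f) {p : ℕ+} (hp : (p : ℕ).Prime)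
    (hN : (p : ℕ) ^ 2 ∣ N) : opU k p f = 0 := by
  obtain ⟨M, hM⟩ := (dvd_pow_self _ two_ne_zero).trans hN
  have hpM : (p : ℕ) ∣ M := by rwa [hM, sq, Nat.mul_dvd_mul_iff_left p.pos] at hN
  have hU := hf.opU_add_eq hp
  rw [if_pos (hM ▸ dvd_mul_right _ _), add_zero] at hU
  have hM_pos : 0 < M := Nat.pos_of_ne_zero fun h ↦ NeZero.ne N (by rw [hM, h, mul_zero])
  rw [hU]
  by_contra h_ne
  refine hf.not_invariant_of_lt (hM ▸ lt_mul_left hM_pos hp.one_lt) (hM ▸ dvd_mul_left _ _)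
    fun γ hγ ↦ smul_right_injective _ (left_ne_zero_of_smul h_ne) ?_
  have h_inv := opU_invariant_of_dvd (fun _ ↦ f.slash_eq) p hpM hM.dvd hγ
  rwa [hU, ModularForm.SL_smul_slash] at h_inv

end IsNormalizedNewform

end Newform

section Fricke

variable {k : ℤ} {p : ℕ+}

/-- The trace of `f | W_p` from prime level `p` to level `1`: the sum of `f | W_p | γ` over `γ = 1`
and `γ = S T ^ b` with `0 ≤ b < p`, where `W_p S = -(1 0; 0 p)`. -/
def frickeTrace (k : ℤ) (p : ℕ+) (f : ℍ → ℂ) : ℍ → ℂ := opU k p f + slash k f (matW p)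

lemma frickeTrace_mem_cuspForms {f : ℍ → ℂ} (hf : f ∈ cuspForms k) (p : ℕ+) :
    frickeTrace k p f ∈ cuspForms k :=
  add_mem (opU_mem_cuspForms hf p) (slash_mem_cuspForms hf (matW_mem_ratGLPos p))

lemma slash_matW_S {f : ℍ → ℂ} (hf : f ∣[k] (-1 : SL(2, ℤ)) = f) (d : ℕ+) :
    slash k f (matW d) ∣[k] ModularGroup.S = slash k f (matB 0 d) :=
  slash_slash_SL (det_pos_matW d) (det_pos_matB 0 d) hf (by
    rw [mapGL_val, mapGL_val, matW_val, matB_val]; simp [ModularGroup.S])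

lemma slash_matW_matW {f : ℍ → ℂ} (hf : f ∣[k] (-1 : SL(2, ℤ)) = f) (d : ℕ+) :
    slash k (slash k f (matW d)) (matW d) = f := by
  have h_mul : matW d * matW d = mapGL ℝ (-1 : SL(2, ℤ)) * (matB 0 d * matV d) := by
    refine Units.ext ?_
    rw [Units.val_mul, Units.val_mul, Units.val_mul, mapGL_val, matB_val, matV_val, matW_val]
    simp
  have h_det : 0 < (matB 0 d * matV d).det.val := by
    rw [map_mul, Units.val_mul]
    exact mul_pos (det_pos_matB 0 d) (det_pos_matV d)
  rw [← slash_mul k f (det_pos_matW d) (det_pos_matW d), h_mul, slash_mul k f (by simp) h_det,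
    slash_mapGL, hf, slash_mul k f (det_pos_matB 0 d) (det_pos_matV d), slash_matB_zero_matV]

section PrimeLevel

variable {f : ℍ → ℂ} (hf : ∀ γ ∈ Gamma0 p, f ∣[k] γ = f)
include hf

lemma slash_neg_one_of_invariant : f ∣[k] (-1 : SL(2, ℤ)) = f :=
  hf _ (mem_Gamma0_iff_dvd.mpr (by simp))

lemma slash_matW_T : slash k f (matW p) ∣[k] ModularGroup.T = slash k f (matW p) := by
  let γ : SL(2, ℤ) := ⟨!![1, 0; -p, 1], by simp [Matrix.det_fin_two_of]⟩
  refine slash_slash_SL (γ' := γ) (det_pos_matW p) (det_pos_matW p)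
    (hf γ (mem_Gamma0_iff_dvd.mpr (by simp [γ]))) ?_
  rw [mapGL_val, mapGL_val, matW_val]
  simp [γ, ModularGroup.T]

lemma frickeTrace_T : frickeTrace k p f ∣[k] ModularGroup.T = frickeTrace k p f := by
  rw [frickeTrace, SlashAction.add_slash, opU_T hf, slash_matW_T hf]

/-- `S` permutes the summands: it swaps `W_p` and `(1 0; 0 p)`, and it sends `(1 b; 0 p)` to
`(1 b'; 0 p)` with `b b' ≡ -1` modulo `p`. -/
lemma frickeTrace_S (hp : (p : ℕ).Prime) :
    frickeTrace k p f ∣[k] ModularGroup.S = frickeTrace k p f := by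
  have : Fact (p : ℕ).Prime := ⟨hp⟩
  have h_swap : (∑ x ∈ Finset.univ.erase (0 : ZMod p), slash k f (matB x.val p)) ∣[k]
      ModularGroup.S = ∑ x ∈ Finset.univ.erase (0 : ZMod p), slash k f (matB x.val p) := by
    rw [SlashAction.sum_slash]
    refine Finset.sum_nbij' (fun x ↦ -x⁻¹) (fun x ↦ -x⁻¹) (by simp) (by simp)
      (by simp [inv_neg]) (by simp [inv_neg]) fun x hx ↦
        slash_matB_slash hf p (by simp [ModularGroup.S]) ?_
    simp [ModularGroup.S, Finset.ne_of_mem_erase hx]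
  rw [frickeTrace, opU_eq_sum_zmod, ← Finset.add_sum_erase _ _ (Finset.mem_univ 0), ZMod.val_zero,
    SlashAction.add_slash, SlashAction.add_slash, h_swap, slash_matB_zero_S,
    slash_matW_S (slash_neg_one_of_invariant hf)]
  abel

end PrimeLevel

lemma petInner_frickeTrace {f g : ℍ → ℂ} (hf : f ∈ cuspForms k) (hg : g ∈ cuspForms k)
    (hS : g ∣[k] ModularGroup.S = g) (hT : g ∣[k] ModularGroup.T = g) (d : ℕ+) :
    petInner k (frickeTrace k d f) g = (d + 1) * petInner k f (slash k g (matV d)) := by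
  have hW : petInner k (slash k f (matW d)) g = petInner k f (slash k g (matV d)) := by
    rw [← petInner_slash_matB_zero hf hg, ← slash_matB_zero_S]
    nth_rw 1 [← hS]
    exact petInner_slash_SL (slash_mem_cuspForms hf (matB_mem_ratGLPos 0 d)) hg _
  rw [frickeTrace, petInner_add_left (opU_mem_cuspForms hf d)
    (slash_mem_cuspForms hf (matW_mem_ratGLPos d)) hg, petInner_opU hf hg hT, hW]
  ring

namespace IsNormalizedNewform

variable {f : CuspSpace p k}

lemma frickeTrace_eq_zero (hf : IsNormalizedNewform p k f) (hp : (p : ℕ).Prime) :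
    frickeTrace k p f = 0 := by
  have h_mem := frickeTrace_mem_cuspForms (coe_mem_cuspForms f) p
  have hS := frickeTrace_S (fun _ ↦ f.slash_eq) hp
  have hT := frickeTrace_T (p := p) (fun _ ↦ f.slash_eq)
  refine eq_zero_of_petInner_self h_mem ?_
  rw [petInner_frickeTrace (coe_mem_cuspForms f) h_mem hS hT,
    hf.petInner_slash_matV_eq_zero h_mem hp.one_lt
      (fun γ _ ↦ slash_eq_self_of_S_of_T hS hT γ) (one_mul _).dvd, mul_zero]

lemma exists_slash_matW_eq_smul (hf : IsNormalizedNewform p k f) (hp : (p : ℕ).Prime) :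
    ∃ ε : ℂ, (ε = 1 ∨ ε = -1) ∧ slash k f (matW p) = ε • (f : ℍ → ℂ) ∧
      opU k p f = -ε • (f : ℍ → ℂ) := by
  have hU := hf.opU_add_eq hp
  rw [if_pos dvd_rfl, add_zero] at hU
  set μ := normalizedCoeff k f p
  have hW : slash k f (matW p) = -μ • (f : ℍ → ℂ) := by
    rw [neg_smul μ (f : ℍ → ℂ), ← hU]
    exact eq_neg_of_add_eq_zero_right (hf.frickeTrace_eq_zero hp)
  refine ⟨-μ, mul_self_eq_one_iff.mp (smul_left_injective ℂ hf.ne_zero ?_), hW, by rwa [neg_neg]⟩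
  have h_sq := slash_matW_matW (slash_neg_one_of_invariant fun _ ↦ f.slash_eq) p
  rw [hW, slash_smul, hW, smul_smul] at h_sq
  simpa only [one_smul] using h_sq

end IsNormalizedNewform

end Fricke

lemma petRatio_two_one (μ : ℂ) : petRatio 2 μ 1 = 1 / 3 * μ := by
  rw [petRatio]; ring

lemma petRatio_two_two (μ : ℂ) : petRatio 2 μ 2 = 1 / 6 * μ ^ 2 - 1 / 2 := by
  rw [petRatio, petRatio_two_one, petRatio]; ring

lemma petRatio_two_three (μ : ℂ) : petRatio 2 μ 3 = 1 / 12 * μ ^ 3 - 5 / 12 * μ := by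
  rw [petRatio, petRatio_two_two, petRatio_two_one]; ring

lemma petRatio_two_four (μ : ℂ) :
    petRatio 2 μ 4 = 1 / 24 * μ ^ 4 - 7 / 24 * μ ^ 2 + 1 / 4 := by
  rw [petRatio, petRatio_two_three, petRatio_two_two]; ring

end VNewform

end

open VNewform in
theorem mainTheorem6_general (k : ℤ) (p : ℕ+) (hp : (p : ℕ).Prime) :
    (∀ (N : ℕ) [NeZero N] (f : CuspSpace N k), (p : ℕ) ^ 2 ∣ N → IsNormalizedNewform N k f →
      ∀ l : ℕ, 1 ≤ l → petV N k f (p ^ l) = 0) ∧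
    (∀ f : CuspSpace p k, IsNormalizedNewform p k f →
      ∃ ε : ℂ, (ε = 1 ∨ ε = -1) ∧ slash k f (matW p) = ε • (f : UpperHalfPlane → ℂ) ∧
        ∀ l : ℕ, petV p k f (p ^ l) =
          (-ε / p) ^ l * pet (CongruenceSubgroup.Gamma0 p) k f f) ∧
    (∀ (N : ℕ) [NeZero N] (f : CuspSpace N k), ¬ (p : ℕ) ∣ N → IsNormalizedNewform N k f →
      ∀ l : ℕ, petV N k f (p ^ l) =
        petRatio p (normalizedCoeff k f p) l * pet (CongruenceSubgroup.Gamma0 N) k f f) := by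
  refine ⟨fun N _ f hN hf l hl ↦ ?_, fun f hf ↦ ?_, fun N _ f hN hf l ↦ ?_⟩
  · have hU := hf.opU_eq_zero hp hN
    rw [← zero_smul ℂ (f : UpperHalfPlane → ℂ)] at hU
    rw [petV_eq_petInner, petInner_slash_matV_pow_of_opU_eq (coe_mem_cuspForms f)
      (fun _ ↦ f.slash_eq) hU, zero_div, zero_pow (by lia), zero_mul]
  · obtain ⟨ε, hε, hW, hU⟩ := hf.exists_slash_matW_eq_smul hp
    refine ⟨ε, hε, hW, fun l ↦ ?_⟩
    rw [petV_eq_petInner, pet_Gamma0_eq_petInner]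
    exact petInner_slash_matV_pow_of_opU_eq (coe_mem_cuspForms f) (fun _ ↦ f.slash_eq) hU l
  · have hU := hf.opU_add_eq hp
    rw [if_neg hN] at hU
    rw [petV_eq_petInner, pet_Gamma0_eq_petInner]
    exact petInner_slash_matV_pow_of_opU_add_eq (coe_mem_cuspForms f) (fun _ ↦ f.slash_eq)
      (hp.coprime_iff_not_dvd.mpr hN) hU l

theorem mainTheorem6 (k : ℤ) (hk : 0 < k) :
    -- level 4
    (∀ f : VNewform.CuspSpace 4 k, VNewform.IsNormalizedNewform 4 k f →
      ∀ l : ℕ, 1 ≤ l → VNewform.petV 4 k f (2 ^ l) = 0) ∧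
    -- level 2; the number `ε` is the eigenvalue of `f` under the Fricke involution
    (∀ f : VNewform.CuspSpace 2 k, VNewform.IsNormalizedNewform 2 k f →
      ∃ ε : ℂ, (ε = 1 ∨ ε = -1) ∧
        VNewform.slash k f (VNewform.matW 2) = ε • (f : UpperHalfPlane → ℂ) ∧
        ∀ l : ℕ, VNewform.petV 2 k f (2 ^ l) =
          (-ε / 2) ^ l * VNewform.pet (CongruenceSubgroup.Gamma0 2) k f f) ∧
    -- level 1
    (∀ f : VNewform.CuspSpace 1 k, VNewform.IsNormalizedNewform 1 k f →
      VNewform.petV 1 k f 2 =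
        (1 / 3 * (VNewform.coeff f 2 / (((2 : ℝ) ^ ((k : ℝ) / 2 - 1) : ℝ) : ℂ))) *
          VNewform.pet (CongruenceSubgroup.Gamma0 1) k f f ∧
      VNewform.petV 1 k f 4 =
        (1 / 6 * (VNewform.coeff f 2 ^ 2 / (((4 : ℝ) ^ ((k : ℝ) / 2 - 1) : ℝ) : ℂ)) - 1 / 2) *
          VNewform.pet (CongruenceSubgroup.Gamma0 1) k f f ∧
      VNewform.petV 1 k f 8 =
        (1 / 12 * (VNewform.coeff f 2 ^ 3 / (((8 : ℝ) ^ ((k : ℝ) / 2 - 1) : ℝ) : ℂ)) -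
          5 / 12 * (VNewform.coeff f 2 / (((2 : ℝ) ^ ((k : ℝ) / 2 - 1) : ℝ) : ℂ))) *
          VNewform.pet (CongruenceSubgroup.Gamma0 1) k f f ∧
      VNewform.petV 1 k f 16 =
        (1 / 24 * (VNewform.coeff f 2 ^ 4 / (((16 : ℝ) ^ ((k : ℝ) / 2 - 1) : ℝ) : ℂ)) -
          7 / 24 * (VNewform.coeff f 2 ^ 2 / (((4 : ℝ) ^ ((k : ℝ) / 2 - 1) : ℝ) : ℂ)) + 1 / 4) *
          VNewform.pet (CongruenceSubgroup.Gamma0 1) k f f) := by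
  open VNewform in
  obtain ⟨h_four, h_two, h_one⟩ := mainTheorem6_general k 2 Nat.prime_two
  refine ⟨fun f ↦ h_four 4 f (by norm_num), h_two, fun f hf ↦ ?_⟩
  have h := h_one 1 f (by norm_num) hf
  simp only [PNat.val_ofNat, Nat.cast_ofNat] at h
  refine ⟨(h 1).trans ?_, (h 2).trans ?_, (h 3).trans ?_, (h 4).trans ?_⟩
  · rw [petRatio_two_one, normalizedCoeff, Nat.cast_ofNat]
  · rw [petRatio_two_two, normalizedCoeff_pow]; norm_num
  · rw [petRatio_two_three, normalizedCoeff_pow, normalizedCoeff]; norm_num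
  · rw [petRatio_two_four, normalizedCoeff_pow, normalizedCoeff_pow]; norm_num
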